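/- **Lemma (Capture prediction for terms).** Consider the capture calculus $\mathsf{CC}_{<:\Box}$ defined below. Let $\vdash \sigma \sim \Delta$ and $\Delta \vdash t : C\,R$, where $\sigma$ is a store context, $\Delta$ a typing context, $t$ a term, $C$ a capture set and $R$ a shape type. If $\sigma[t] \longrightarrow^* \sigma[\sigma'[a]]$ for a store context $\sigma'$ and an answer $a$, then $\Delta \vdash \mathrm{cv}(\sigma'[a]) <: C$. **Syntax** (up to renaming of bound variables; all variables bound in a context are distinct). Values $v ::= \lambda(x:U)t \mid \lambda[X<:S]t \mid \Box x$; answers $a ::= v \mid x$; terms $s,t ::= a \mid x\,y \mid x[S] \mid \mathsf{let}\ x=s\ \mathsf{in}\ t \mid C \mathbin{\circ\!-} x$; shape types $S,R ::= X \mid \top \mid \forall(x:U)T \mid \forall[X<:S]T \mid \Box T$; types $T,U ::= S \mid C\,S$, with $S$ identified with $\{\}\,S$; capture sets $C$ are finite sets of term variables and the special variable $*$, which is never bound; typing contexts $\Gamma,\Delta ::= \cdot \mid \Gamma,x:T \mid \Gamma,X<:S$; $\mathrm{dom}(\Gamma)$ is the set of variables bound in $\Gamma$. Store contexts $\sigma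 ::= [\,] \mid \mathsf{let}\ x=v\ \mathsf{in}\ \sigma$; evaluation contexts $e ::= [\,] \mid \mathsf{let}\ x=e\ \mathsf{in}\ t$; $\sigma(x)$ is the value bound to $x$ in $\sigma$. **Captured variables.** $\mathrm{cv}(\lambda(x:U)t)=\mathrm{cv}(t)\setminus x$; $\mathrm{cv}(\lambda[X<:S]t)=\mathrm{cv}(t)$; $\mathrm{cv}(x)=\{x\}$; $\mathrm{cv}(\Box x)=\{\}$; $\mathrm{cv}(x\,y)=\{x,y\}$; $\mathrm{cv}(x[S])=\{x\}$; $\mathrm{cv}(C\mathbin{\circ\!-}x)=C\cup\{x\}$; $\mathrm{cv}(\mathsf{let}\ x=s\ \mathsf{in}\ t)=\mathrm{cv}(t)$ if $s$ is a value and $x\notin\mathrm{cv}(t)$, and $\mathrm{cv}(s)\cup(\mathrm{cv}(t)\setminus x)$ otherwise. **Well-formedness.** $\Gamma\vdash T\ \mathbf{wf}$ means that the free type variables of $T$ and the free term variables in its capture sets other than $*$ are bound in $\Gamma$ (extended by the enclosing binders). **Subcapturing** $\Gamma\vdash C_1<:C_2$ is generated by: $\Gamma\vdash\{x\}<:C$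 if $x\in C$ (including $x=*$); $\Gamma\vdash C_1<:C_2$ if $\Gamma\vdash\{x\}<:C_2$ for all $x\in C_1$; $\Gamma\vdash\{x\}<:C$ if $x:C'\,S\in\Gamma$ and $\Gamma\vdash C'<:C$. **Subtyping** $\Gamma\vdash T_1<:T_2$ is generated by reflexivity, transitivity, and: $\Gamma\vdash X<:S$ if $X<:S\in\Gamma$; $\Gamma\vdash S<:\top$; $\Gamma\vdash\forall(x:U_1)T_1<:\forall(x:U_2)T_2$ if $\Gamma\vdash U_2<:U_1$ and $\Gamma,x:U_2\vdash T_1<:T_2$; $\Gamma\vdash\forall[X<:S_1]T_1<:\forall[X<:S_2]T_2$ if $\Gamma\vdash S_2<:S_1$ and $\Gamma,X<:S_2\vdash T_1<:T_2$; $\Gamma\vdash C_1\,S_1<:C_2\,S_2$ if $\Gamma\vdash C_1<:C_2$ and $\Gamma\vdash S_1<:S_2$; $\Gamma\vdash\Box T_1<:\Box T_2$ if $\Gamma\vdash T_1<:T_2$. **Typing** $\Gamma\vdash t:T$ is generated by: - $\Gamma\vdash x:\{x\}\,S$ if $x:C\,S\in\Gamma$; - $\Gamma\vdash t:U$ if $\Gamma\vdash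 t:T$, $\Gamma\vdash T<:U$ and $\Gamma\vdash U\ \mathbf{wf}$; - $\Gamma\vdash\lambda(x:U)t:(\mathrm{cv}(t)\setminus x)\ \forall(x:U)T$ if $\Gamma,x:U\vdash t:T$ and $\Gamma\vdash U\ \mathbf{wf}$; - $\Gamma\vdash\lambda[X<:S]t:\mathrm{cv}(t)\ \forall[X<:S]T$ if $\Gamma,X<:S\vdash t:T$ and $\Gamma\vdash S\ \mathbf{wf}$; - $\Gamma\vdash x\,y:[z:=y]T$ if $\Gamma\vdash x:C\,\forall(z:U)T$ and $\Gamma\vdash y:U$; - $\Gamma\vdash x[S]:[X:=S]T$ if $\Gamma\vdash x:C\,\forall[X<:S]T$; - $\Gamma\vdash\Box x:\Box\,C\,S$ if $\Gamma\vdash x:C\,S$ and $C\subseteq\mathrm{dom}(\Gamma)$; - $\Gamma\vdash C\mathbin{\circ\!-}x:C\,S$ if $\Gamma\vdash x:\Box\,C\,S$ and $C\subseteq\mathrm{dom}(\Gamma)$; - $\Gamma\vdash\mathsf{let}\ x=s\ \mathsf{in}\ t:U$ if $\Gamma\vdash s:T$, $\Gamma,x:T\vdash t:U$ and $x\notin\mathrm{fv}(U)$.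 **Evaluation** $\longrightarrow$ is given by the following steps (capture-avoiding), and $\longrightarrow^*$ is its reflexive transitive closure: - $\sigma[e[x\,y]]\longrightarrow\sigma[e[[z:=y]t]]$ if $\sigma(x)=\lambda(z:U)t$; - $\sigma[e[x[S]]]\longrightarrow\sigma[e[[X:=S]t]]$ if $\sigma(x)=\lambda[X<:S']t$; - $\sigma[e[C\mathbin{\circ\!-}x]]\longrightarrow\sigma[e[y]]$ if $\sigma(x)=\Box y$; - $\sigma[e[\mathsf{let}\ x=y\ \mathsf{in}\ t]]\longrightarrow\sigma[e[[x:=y]t]]$; - $\sigma[e[\mathsf{let}\ x=v\ \mathsf{in}\ t]]\longrightarrow\sigma[\mathsf{let}\ x=v\ \mathsf{in}\ e[t]]$ if $e\neq[\,]$. **Matching** $\Gamma\vdash\sigma\sim\Delta$ is generated by: $\Gamma\vdash[\,]\sim\cdot$; and $\Gamma\vdash(\mathsf{let}\ x=v\ \mathsf{in}\ \sigma)\sim(x:T,\Delta)$ if $\Gamma,x:T\vdash\sigma\sim\Delta$, $\Gamma\vdash v:T$ and $x\notin\mathrm{fv}(T)$. An omitted $\Gamma$ is the empty context. -/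

import Mathlib

/-!
The capture calculus: a dependently typed variant of System F-sub in monadic normal form, with
capturing types and boxes.

Binding is represented by de Bruijn indices, so that terms, types and contexts are identified up to
renaming of bound variables.  Term variables and type variables are counted separately: a term
binder shifts only the indices of term variables, a type binder only those of type variables.
-/

namespace CaptureCalculus

/-! ### Capture sets -/

/-- A capture set is a finite set of term variables `some x` and of the special variable `none`,
which stands for the universal capability `*`. -/
abbrev CapSet : Type := Finset (Option ℕ)

/-- The action of a map of term variables on a capture set (the universal capability is fixed). -/
def CapSet.ren (f : ℕ → ℕ) (C : CapSet) : CapSet := C.image (Option.map f)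

/-- `C \ x` for the innermost term variable `x`, as a capture set in the scope outside `x`. -/
def CapSet.unbind (C : CapSet) : CapSet := (C.erase (some 0)).image (Option.map Nat.pred)

/-! ### Types -/

mutual
  /-- Shape types `S ::= X | ⊤ | ∀(x : U) T | ∀[X <: S] T | □ T`. -/
  inductive Shape : Type
    | tvar (X : ℕ) : Shape
    | top : Shape
    | fn (U T : Ty) : Shape
    | tfn (S : Shape) (T : Ty) : Shape
    | box (T : Ty) : Shape
  /-- Types `T ::= C S`; a shape type `S` used as a type is `{} S`. -/
  inductive Ty : Type
    | capt (C : CapSet) (S : Shape) : Ty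
end

/-- The shape type `S`, seen as the type `{} S`. -/
abbrev Shape.toTy (S : Shape) : Ty := .capt ∅ S

/-- The map of indices `f`, carried under one binder. -/
def lift (f : ℕ → ℕ) : ℕ → ℕ
  | 0 => 0
  | n + 1 => f n + 1

mutual
  /-- Replace the term variables by `f` and the type variables by `g`. -/
  def Shape.ren (f g : ℕ → ℕ) : Shape → Shape
    | .tvar X => .tvar (g X)
    | .top => .top
    | .fn U T => .fn (U.ren f g) (T.ren (lift f) g)
    | .tfn S T => .tfn (S.ren f g) (T.ren f (lift g))
    | .box T => .box (T.ren f g)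
  /-- Replace the term variables by `f` and the type variables by `g`. -/
  def Ty.ren (f g : ℕ → ℕ) : Ty → Ty
    | .capt C S => .capt (C.ren f) (S.ren f g)
end

/-- A substitution of shape types for type variables, carried under a term binder. -/
def liftTm (g : ℕ → Shape) : ℕ → Shape := fun X => (g X).ren Nat.succ id

/-- A substitution of shape types for type variables, carried under a type binder. -/
def liftTy (g : ℕ → Shape) : ℕ → Shape
  | 0 => .tvar 0
  | X + 1 => (g X).ren id Nat.succ

mutual
  /-- Capture-avoiding substitution of shape types for type variables. -/
  def Shape.tsubst (g : ℕ → Shape) : Shape → Shape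
    | .tvar X => g X
    | .top => .top
    | .fn U T => .fn (U.tsubst g) (T.tsubst (liftTm g))
    | .tfn S T => .tfn (S.tsubst g) (T.tsubst (liftTy g))
    | .box T => .box (T.tsubst g)
  /-- Capture-avoiding substitution of shape types for type variables. -/
  def Ty.tsubst (g : ℕ → Shape) : Ty → Ty
    | .capt C S => .capt C (S.tsubst g)
end

/-- The map of variables `[z := y]` for the innermost variable `z`. -/
def instVar (y : ℕ) : ℕ → ℕ
  | 0 => y
  | n + 1 => n

/-- The substitution `[X := S]` for the innermost type variable `X`. -/
def instTy (S : Shape) : ℕ → Shape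
  | 0 => S
  | X + 1 => .tvar X

/-! ### Terms -/

/-- Terms
`t ::= x | λ(x : U) t | λ[X <: S] t | □ x | x y | x [S] | let x = s in t | C ∘- x`. -/
inductive Tm : Type
  | var (x : ℕ) : Tm
  | lam (U : Ty) (t : Tm) : Tm
  | tlam (S : Shape) (t : Tm) : Tm
  | box (x : ℕ) : Tm
  | app (x y : ℕ) : Tm
  | tapp (x : ℕ) (S : Shape) : Tm
  | letin (s t : Tm) : Tm
  | unbox (C : CapSet) (x : ℕ) : Tm

/-- Values `v ::= λ(x : U) t | λ[X <: S] t | □ x`. -/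
def Tm.isValue : Tm → Bool
  | .lam _ _ => true
  | .tlam _ _ => true
  | .box _ => true
  | _ => false

/-- Answers `a ::= v | x`. -/
def Tm.isAnswer : Tm → Bool
  | .var _ => true
  | t => t.isValue

/-- Replace the term variables by `f` and the type variables by `g`. -/
def Tm.ren (f g : ℕ → ℕ) : Tm → Tm
  | .var x => .var (f x)
  | .lam U t => .lam (U.ren f g) (t.ren (lift f) g)
  | .tlam S t => .tlam (S.ren f g) (t.ren f (lift g))
  | .box x => .box (f x)
  | .app x y => .app (f x) (f y)
  | .tapp x S => .tapp (f x) (S.ren f g)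
  | .letin s t => .letin (s.ren f g) (t.ren (lift f) g)
  | .unbox C x => .unbox (C.ren f) (f x)

/-- Capture-avoiding substitution of shape types for type variables. -/
def Tm.tsubst (g : ℕ → Shape) : Tm → Tm
  | .var x => .var x
  | .lam U t => .lam (U.tsubst g) (t.tsubst (liftTm g))
  | .tlam S t => .tlam (S.tsubst g) (t.tsubst (liftTy g))
  | .box x => .box x
  | .app x y => .app x y
  | .tapp x S => .tapp x (S.tsubst g)
  | .letin s t => .letin (s.tsubst g) (t.tsubst (liftTm g))
  | .unbox C x => .unbox C x

/-- The captured variables of a term. -/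
def Tm.cv : Tm → CapSet
  | .var x => {some x}
  | .lam _ t => t.cv.unbind
  | .tlam _ t => t.cv
  | .box _ => ∅
  | .app x y => {some x, some y}
  | .tapp x _ => {some x}
  | .letin s t =>
      if s.isValue = true ∧ some 0 ∉ t.cv then t.cv.unbind else s.cv ∪ t.cv.unbind
  | .unbox C x => C ∪ {some x}

/-! ### Contexts and well-formedness -/

/-- Typing contexts `Γ ::= · | Γ, x : T | Γ, X <: S`. -/
inductive Ctx : Type
  | nil : Ctx
  | var (Γ : Ctx) (T : Ty) : Ctx
  | tvar (Γ : Ctx) (S : Shape) : Ctx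

/-- `x : T ∈ Γ`, where `T` is read in the scope of the whole of `Γ`. -/
inductive HasVar : Ctx → ℕ → Ty → Prop
  | here {Γ : Ctx} {T : Ty} : HasVar (.var Γ T) 0 (T.ren Nat.succ id)
  | skipVar {Γ : Ctx} {x : ℕ} {T U : Ty} :
      HasVar Γ x T → HasVar (.var Γ U) (x + 1) (T.ren Nat.succ id)
  | skipTVar {Γ : Ctx} {x : ℕ} {T : Ty} {S : Shape} :
      HasVar Γ x T → HasVar (.tvar Γ S) x (T.ren id Nat.succ)

/-- `X <: S ∈ Γ`, where `S` is read in the scope of the whole of `Γ`. -/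
inductive HasTVar : Ctx → ℕ → Shape → Prop
  | here {Γ : Ctx} {S : Shape} : HasTVar (.tvar Γ S) 0 (S.ren id Nat.succ)
  | skipVar {Γ : Ctx} {X : ℕ} {S : Shape} {U : Ty} :
      HasTVar Γ X S → HasTVar (.var Γ U) X (S.ren Nat.succ id)
  | skipTVar {Γ : Ctx} {X : ℕ} {S S' : Shape} :
      HasTVar Γ X S → HasTVar (.tvar Γ S') (X + 1) (S.ren id Nat.succ)

/-- The term variables bound in `Γ`, as elements of capture sets. -/
def Ctx.dom (Γ : Ctx) : Set (Option ℕ) := {c | ∃ x T, c = some x ∧ HasVar Γ x T}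

mutual
  /-- Well-formedness `Γ ⊢ S wf` of shape types. -/
  def Shape.WF : Ctx → Shape → Prop
    | Γ, .tvar X => ∃ S, HasTVar Γ X S
    | _, .top => True
    | Γ, .fn U T => U.WF Γ ∧ T.WF (.var Γ U)
    | Γ, .tfn S T => S.WF Γ ∧ T.WF (.tvar Γ S)
    | Γ, .box T => T.WF Γ
  /-- Well-formedness `Γ ⊢ T wf` of types: capture sets may contain the variables bound in `Γ` and
  the universal capability. -/
  def Ty.WF : Ctx → Ty → Prop
    | Γ, .capt C S => S.WF Γ ∧ (C : Set (Option ℕ)) ⊆ Γ.dom ∪ {none}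
end

/-! ### Subcapturing, subtyping, typing -/

/-- Subcapturing `Γ ⊢ C₁ <: C₂`. -/
inductive Subcapt : Ctx → CapSet → CapSet → Prop
  | elem {Γ : Ctx} {c : Option ℕ} {C : CapSet} : c ∈ C → Subcapt Γ {c} C
  | set {Γ : Ctx} {C₁ C₂ : CapSet} : (∀ c ∈ C₁, Subcapt Γ {c} C₂) → Subcapt Γ C₁ C₂
  | var {Γ : Ctx} {x : ℕ} {C' C : CapSet} {S : Shape} :
      HasVar Γ x (.capt C' S) → Subcapt Γ C' C → Subcapt Γ {some x} C

/-- Subtyping `Γ ⊢ T₁ <: T₂`; a shape type `S` is identified with `{} S`. -/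
inductive Subtyp : Ctx → Ty → Ty → Prop
  | refl {Γ : Ctx} {T : Ty} : Subtyp Γ T T
  | trans {Γ : Ctx} {T₁ T₂ T₃ : Ty} : Subtyp Γ T₁ T₂ → Subtyp Γ T₂ T₃ → Subtyp Γ T₁ T₃
  | tvar {Γ : Ctx} {X : ℕ} {S : Shape} :
      HasTVar Γ X S → Subtyp Γ (Shape.tvar X).toTy S.toTy
  | top {Γ : Ctx} {S : Shape} : Subtyp Γ S.toTy Shape.top.toTy
  | fn {Γ : Ctx} {U₁ U₂ T₁ T₂ : Ty} :
      Subtyp Γ U₂ U₁ → Subtyp (.var Γ U₂) T₁ T₂ →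
      Subtyp Γ (Shape.fn U₁ T₁).toTy (Shape.fn U₂ T₂).toTy
  | tfn {Γ : Ctx} {S₁ S₂ : Shape} {T₁ T₂ : Ty} :
      Subtyp Γ S₂.toTy S₁.toTy → Subtyp (.tvar Γ S₂) T₁ T₂ →
      Subtyp Γ (Shape.tfn S₁ T₁).toTy (Shape.tfn S₂ T₂).toTy
  | capt {Γ : Ctx} {C₁ C₂ : CapSet} {S₁ S₂ : Shape} :
      Subcapt Γ C₁ C₂ → Subtyp Γ S₁.toTy S₂.toTy → Subtyp Γ (.capt C₁ S₁) (.capt C₂ S₂)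
  | boxed {Γ : Ctx} {T₁ T₂ : Ty} :
      Subtyp Γ T₁ T₂ → Subtyp Γ (Shape.box T₁).toTy (Shape.box T₂).toTy

/-- Typing `Γ ⊢ t : T`.  In `letin`, that the bound variable is not free in the result type `U` is
expressed by `U` being a type in the scope of `Γ`, which is shifted into the scope of the body. -/
inductive HasType : Ctx → Tm → Ty → Prop
  | var {Γ : Ctx} {x : ℕ} {C : CapSet} {S : Shape} :
      HasVar Γ x (.capt C S) → HasType Γ (.var x) (.capt {some x} S)
  | sub {Γ : Ctx} {t : Tm} {T U : Ty} :
      HasType Γ t T → Subtyp Γ T U → U.WF Γ → HasType Γ t U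
  | abs {Γ : Ctx} {t : Tm} {U T : Ty} :
      HasType (.var Γ U) t T → U.WF Γ →
      HasType Γ (.lam U t) (.capt t.cv.unbind (.fn U T))
  | tabs {Γ : Ctx} {t : Tm} {S : Shape} {T : Ty} :
      HasType (.tvar Γ S) t T → S.WF Γ →
      HasType Γ (.tlam S t) (.capt t.cv (.tfn S T))
  | app {Γ : Ctx} {x y : ℕ} {C : CapSet} {U T : Ty} :
      HasType Γ (.var x) (.capt C (.fn U T)) → HasType Γ (.var y) U →
      HasType Γ (.app x y) (T.ren (instVar y) id)
  | tapp {Γ : Ctx} {x : ℕ} {C : CapSet} {S : Shape} {T : Ty} :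
      HasType Γ (.var x) (.capt C (.tfn S T)) →
      HasType Γ (.tapp x S) (T.tsubst (instTy S))
  | box {Γ : Ctx} {x : ℕ} {C : CapSet} {S : Shape} :
      HasType Γ (.var x) (.capt C S) → (C : Set (Option ℕ)) ⊆ Γ.dom →
      HasType Γ (.box x) (Shape.box (.capt C S)).toTy
  | unbox {Γ : Ctx} {x : ℕ} {C : CapSet} {S : Shape} :
      HasType Γ (.var x) (Shape.box (.capt C S)).toTy → (C : Set (Option ℕ)) ⊆ Γ.dom →
      HasType Γ (.unbox C x) (.capt C S)
  | letin {Γ : Ctx} {s t : Tm} {T U : Ty} :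
      HasType Γ s T → HasType (.var Γ T) t (U.ren Nat.succ id) →
      HasType Γ (.letin s t) U

/-! ### Evaluation -/

/-- Store contexts `σ ::= [] | let x = v in σ`. -/
inductive Store : Type
  | hole : Store
  | letv (v : Tm) (hv : v.isValue = true) (σ : Store) : Store

/-- `σ[t]`; the variables bound by `σ` are in scope in `t`. -/
def Store.plug : Store → Tm → Tm
  | .hole, t => t
  | .letv v _ σ, t => .letin v (σ.plug t)

/-- The number of variables bound by a store context. -/
def Store.length : Store → ℕ
  | .hole => 0
  | .letv _ _ σ => σ.length + 1

/-- `σ(x)`, the value bound to `x` in `σ`.  Both the variable and the value are read in the scope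
of the hole of `σ`. -/
def Store.lookup : Store → ℕ → Option Tm
  | .hole, _ => none
  | .letv v _ σ, x =>
      if x = σ.length then some (v.ren (fun i => i + (σ.length + 1)) id) else σ.lookup x

/-- Evaluation contexts `e ::= [] | let x = e in t`. -/
inductive ECtx : Type
  | hole : ECtx
  | letin (e : ECtx) (t : Tm) : ECtx

/-- `e[s]`. -/
def ECtx.plug : ECtx → Tm → Tm
  | .hole, s => s
  | .letin e t, s => .letin (e.plug s) t

/-- The evaluation context `e`, moved under one further term binder. -/
def ECtx.weaken : ECtx → ECtx
  | .hole => .hole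
  | .letin e t => .letin e.weaken (t.ren (lift Nat.succ) id)

/-- One step of evaluation `t ⟶ t'`. -/
inductive Step : Tm → Tm → Prop
  | apply {σ : Store} {e : ECtx} {x y : ℕ} {U : Ty} {t : Tm} :
      σ.lookup x = some (.lam U t) →
      Step (σ.plug (e.plug (.app x y))) (σ.plug (e.plug (t.ren (instVar y) id)))
  | tapply {σ : Store} {e : ECtx} {x : ℕ} {S S' : Shape} {t : Tm} :
      σ.lookup x = some (.tlam S' t) →
      Step (σ.plug (e.plug (.tapp x S))) (σ.plug (e.plug (t.tsubst (instTy S))))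
  | unbox {σ : Store} {e : ECtx} {x y : ℕ} {C : CapSet} :
      σ.lookup x = some (.box y) →
      Step (σ.plug (e.plug (.unbox C x))) (σ.plug (e.plug (.var y)))
  | rename {σ : Store} {e : ECtx} {y : ℕ} {t : Tm} :
      Step (σ.plug (e.plug (.letin (.var y) t))) (σ.plug (e.plug (t.ren (instVar y) id)))
  | lift {σ : Store} {e : ECtx} {v t : Tm} :
      v.isValue = true → e ≠ .hole →
      Step (σ.plug (e.plug (.letin v t))) (σ.plug (.letin v (e.weaken.plug t)))

/-- Evaluation in zero or more steps `t ⟶* t'`. -/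
abbrev Steps : Tm → Tm → Prop := Relation.ReflTransGen Step

/-! ### Matching of store contexts and typing contexts -/

/-- `Γ, Δ` for a sequence `Δ` of bindings of term variables, the outermost binding first. -/
def Ctx.append (Γ : Ctx) (Δ : List Ty) : Ctx := Δ.foldl Ctx.var Γ

/-- `Γ ⊢ σ ∼ Δ`.  The bound variable is not free in `T`, since `T` is in the scope of `Γ`. -/
inductive Matches : Ctx → Store → List Ty → Prop
  | hole {Γ : Ctx} : Matches Γ .hole []
  | letv {Γ : Ctx} {v : Tm} {hv : v.isValue = true} {σ : Store} {T : Ty} {Δ : List Ty} :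
      Matches (.var Γ T) σ Δ → HasType Γ v T → Matches Γ (.letv v hv σ) (T :: Δ)

end CaptureCalculus

namespace CaptureCalculus

/-! ### Algebra of renamings and substitutions -/

-- The proof combines type preservation with a bound on the captured variables of a result.
--
-- Preservation: no step disturbs `σ`. Its bindings are values and a redex is never a value-binding
-- `let`, so the store used by a step always extends `σ` (`Store.eq_comp`, `ECtx.plug_ne`). Every
-- reduct of `σ[t]` thus has the form `σ[t']`, and `t'` keeps exactly the type `C R` under `Δ`
-- (`Steps.preservation`). Since `σ.plug` is injective, `σ'[a]` itself has type `C R`. The redex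
-- cases rest on a single substitution lemma, `HasType.sub_mor`, and on inversion of subtyping. The
-- inversion is simple because a context matching a store binds no type variables, so a shape below
-- a function or box shape is again one.
--
-- Bound: `HasType.cv_plug_answer` is an induction on `σ'`. The typing rules annotate an answer with
-- its own captured variables, and subsumption only enlarges this set. For `let x = v in u`, the
-- induction hypothesis bounds `cv(u)` by `C` in the context extended by `x : V`, where `C` does not
-- mention `x`. `Subcapt.strengthen` removes `x`: if `x` is captured by `u`, the derivation must
-- pass through the capture set of `V`, which bounds `cv(v)`. If `x` is not captured, nothing bounds
-- `cv(v)`, but then the definition of `cv` omits it.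

theorem lift_id : lift id = id := by
  funext n; cases n <;> rfl

theorem lift_comp (f' f : ℕ → ℕ) : lift f' ∘ lift f = lift (f' ∘ f) := by
  funext n; cases n <;> rfl

@[simp] theorem CapSet.ren_id (C : CapSet) : C.ren id = C := by
  simp [CapSet.ren]

@[simp] theorem CapSet.ren_ren (f' f : ℕ → ℕ) (C : CapSet) :
    (C.ren f).ren f' = C.ren (f' ∘ f) := by
  simp [CapSet.ren, Finset.image_image, Option.map_comp_map]

@[simp] theorem CapSet.ren_singleton (f : ℕ → ℕ) (c : Option ℕ) :
    CapSet.ren f {c} = {c.map f} := by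
  simp [CapSet.ren]

@[simp] theorem CapSet.ren_empty (f : ℕ → ℕ) : CapSet.ren f ∅ = ∅ := rfl

theorem CapSet.mem_ren {f : ℕ → ℕ} {C : CapSet} {c : Option ℕ} :
    c ∈ C.ren f ↔ ∃ d ∈ C, d.map f = c := by
  simp [CapSet.ren]

/-- Index `0` is erased before `Nat.pred` is applied, so the collision of `0` and `1` under
`Nat.pred` never arises. All later reasoning about `unbind` goes through this form. -/
theorem CapSet.mem_unbind {C : CapSet} {c : Option ℕ} :
    c ∈ C.unbind ↔ c.map Nat.succ ∈ C := by
  simp only [CapSet.unbind, Finset.mem_image, Finset.mem_erase]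
  constructor
  · rintro ⟨_ | _ | n, ⟨h0, h⟩, rfl⟩
    · exact h
    · exact absurd rfl h0
    · exact h
  · intro h
    refine ⟨_, ⟨?_, h⟩, ?_⟩ <;> cases c <;> simp

theorem CapSet.zero_mem_ren_lift {f : ℕ → ℕ} {C : CapSet} :
    some 0 ∈ C.ren (lift f) ↔ some 0 ∈ C := by
  rw [CapSet.mem_ren]
  constructor
  · rintro ⟨_ | _ | n, h, e⟩
    · simp at e
    · exact h
    · simp [lift] at e
  · exact fun h => ⟨_, h, rfl⟩

theorem CapSet.unbind_ren_lift (f : ℕ → ℕ) (C : CapSet) :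
    (C.ren (lift f)).unbind = C.unbind.ren f := by
  ext c
  rw [CapSet.mem_unbind, CapSet.mem_ren, CapSet.mem_ren]
  constructor
  · rintro ⟨d, h, e⟩
    cases d with
    | none => exact ⟨none, CapSet.mem_unbind.2 h, by cases c <;> simp_all⟩
    | some n =>
      cases n with
      | zero => cases c <;> simp [lift] at e
      | succ n => exact ⟨some n, CapSet.mem_unbind.2 h, by cases c <;> simp_all [lift]⟩
  · rintro ⟨d, h, rfl⟩
    exact ⟨_, CapSet.mem_unbind.1 h, by cases d <;> rfl⟩

/-- The capture set of a type. -/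
def Ty.cs : Ty → CapSet
  | .capt C _ => C

/-- The shape of a type. -/
def Ty.sh : Ty → Shape
  | .capt _ S => S

mutual
  /-- Simultaneous renaming of term variables by `f` and substitution of type variables by `g`. -/
  def Shape.sub (f : ℕ → ℕ) (g : ℕ → Shape) : Shape → Shape
    | .tvar X => g X
    | .top => .top
    | .fn U T => .fn (U.sub f g) (T.sub (lift f) (liftTm g))
    | .tfn S T => .tfn (S.sub f g) (T.sub f (liftTy g))
    | .box T => .box (T.sub f g)
  /-- Simultaneous renaming of term variables by `f` and substitution of type variables by `g`. -/
  def Ty.sub (f : ℕ → ℕ) (g : ℕ → Shape) : Ty → Ty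
    | .capt C S => .capt (C.ren f) (S.sub f g)
end

theorem liftTm_tvar (g : ℕ → ℕ) :
    liftTm (fun X => .tvar (g X)) = fun X => .tvar (g X) := rfl

theorem liftTy_tvar (g : ℕ → ℕ) :
    liftTy (fun X => .tvar (g X)) = fun X => .tvar (lift g X) := by
  funext X; cases X <;> rfl

mutual
  theorem Shape.ren_eq_sub (f g : ℕ → ℕ) (S : Shape) :
      S.ren f g = S.sub f (fun X => .tvar (g X)) := by
    cases S with
    | tvar X => rfl
    | top => rfl
    | fn U T => rw [Shape.ren, Shape.sub, U.ren_eq_sub, T.ren_eq_sub, liftTm_tvar]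
    | tfn S T => rw [Shape.ren, Shape.sub, S.ren_eq_sub, T.ren_eq_sub, liftTy_tvar]
    | box T => rw [Shape.ren, Shape.sub, T.ren_eq_sub]
  theorem Ty.ren_eq_sub (f g : ℕ → ℕ) (T : Ty) :
      T.ren f g = T.sub f (fun X => .tvar (g X)) := by
    cases T with
    | capt C S => rw [Ty.ren, Ty.sub, S.ren_eq_sub]
end

mutual
  theorem Shape.tsubst_eq_sub (g : ℕ → Shape) (S : Shape) : S.tsubst g = S.sub id g := by
    cases S with
    | tvar X => rfl
    | top => rfl
    | fn U T => rw [Shape.tsubst, Shape.sub, U.tsubst_eq_sub, T.tsubst_eq_sub, lift_id]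
    | tfn S T => rw [Shape.tsubst, Shape.sub, S.tsubst_eq_sub, T.tsubst_eq_sub]
    | box T => rw [Shape.tsubst, Shape.sub, T.tsubst_eq_sub]
  theorem Ty.tsubst_eq_sub (g : ℕ → Shape) (T : Ty) : T.tsubst g = T.sub id g := by
    cases T with
    | capt C S => rw [Ty.tsubst, Ty.sub, S.tsubst_eq_sub, CapSet.ren_id]
end

mutual
  theorem Shape.sub_id (S : Shape) : S.sub id .tvar = S := by
    cases S with
    | tvar X => rfl
    | top => rfl
    | fn U T =>
      have h : liftTm .tvar = .tvar := rfl
      rw [Shape.sub, U.sub_id, lift_id, h, T.sub_id]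
    | tfn S T =>
      have h : liftTy .tvar = .tvar := by funext X; cases X <;> rfl
      rw [Shape.sub, S.sub_id, h, T.sub_id]
    | box T => rw [Shape.sub, T.sub_id]
  theorem Ty.sub_id (T : Ty) : T.sub id .tvar = T := by
    cases T with
    | capt C S => rw [Ty.sub, S.sub_id, CapSet.ren_id]
end

mutual
  -- The composition laws are proved in a forced order. A renaming followed by a substitution needs
  -- nothing else; it yields `Shape.ren_ren`, which handles binders in `Shape.ren_sub`; both orders
  -- together handle binders in `Shape.sub_sub`.
  theorem Shape.sub_ren (f g f' : ℕ → ℕ) (g' : ℕ → Shape) (S : Shape) :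
      (S.ren f g).sub f' g' = S.sub (f' ∘ f) (fun X => g' (g X)) := by
    cases S with
    | tvar X => rfl
    | top => rfl
    | fn U T =>
      rw [Shape.ren, Shape.sub, Shape.sub, U.sub_ren, T.sub_ren, lift_comp]
      rfl
    | tfn S T =>
      have h : (fun X => liftTy g' (lift g X)) = liftTy (fun X => g' (g X)) := by
        funext X; cases X <;> rfl
      rw [Shape.ren, Shape.sub, Shape.sub, S.sub_ren, T.sub_ren, h]
    | box T => rw [Shape.ren, Shape.sub, Shape.sub, T.sub_ren]
  theorem Ty.sub_ren (f g f' : ℕ → ℕ) (g' : ℕ → Shape) (T : Ty) :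
      (T.ren f g).sub f' g' = T.sub (f' ∘ f) (fun X => g' (g X)) := by
    cases T with
    | capt C S => rw [Ty.ren, Ty.sub, Ty.sub, S.sub_ren, CapSet.ren_ren]
end

theorem Shape.ren_ren (f g f' g' : ℕ → ℕ) (S : Shape) :
    (S.ren f g).ren f' g' = S.ren (f' ∘ f) (g' ∘ g) := by
  rw [Shape.ren_eq_sub f', Shape.sub_ren, Shape.ren_eq_sub]; rfl

theorem Ty.ren_ren (f g f' g' : ℕ → ℕ) (T : Ty) :
    (T.ren f g).ren f' g' = T.ren (f' ∘ f) (g' ∘ g) := by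
  rw [Ty.ren_eq_sub f', Ty.sub_ren, Ty.ren_eq_sub]; rfl

mutual
  theorem Shape.ren_sub (f : ℕ → ℕ) (g : ℕ → Shape) (f' g' : ℕ → ℕ) (S : Shape) :
      (S.sub f g).ren f' g' = S.sub (f' ∘ f) (fun X => (g X).ren f' g') := by
    cases S with
    | tvar X => rfl
    | top => rfl
    | fn U T =>
      have h : (fun X => (liftTm g X).ren (lift f') g') = liftTm (fun X => (g X).ren f' g') := by
        funext X; simp only [liftTm, Shape.ren_ren]; rfl
      rw [Shape.sub, Shape.sub, Shape.ren, U.ren_sub, T.ren_sub, lift_comp, h]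
    | tfn S T =>
      have h : (fun X => (liftTy g X).ren f' (lift g')) = liftTy (fun X => (g X).ren f' g') := by
        funext X
        cases X with
        | zero => rfl
        | succ X => simp only [liftTy, Shape.ren_ren]; rfl
      rw [Shape.sub, Shape.sub, Shape.ren, S.ren_sub, T.ren_sub, h]
    | box T => rw [Shape.sub, Shape.sub, Shape.ren, T.ren_sub]
  theorem Ty.ren_sub (f : ℕ → ℕ) (g : ℕ → Shape) (f' g' : ℕ → ℕ) (T : Ty) :
      (T.sub f g).ren f' g' = T.sub (f' ∘ f) (fun X => (g X).ren f' g') := by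
    cases T with
    | capt C S => rw [Ty.sub, Ty.sub, Ty.ren, S.ren_sub, CapSet.ren_ren]
end

mutual
  theorem Shape.sub_sub (f : ℕ → ℕ) (g : ℕ → Shape) (f' : ℕ → ℕ) (g' : ℕ → Shape) (S : Shape) :
      (S.sub f g).sub f' g' = S.sub (f' ∘ f) (fun X => (g X).sub f' g') := by
    cases S with
    | tvar X => rfl
    | top => rfl
    | fn U T =>
      have h : (fun X => (liftTm g X).sub (lift f') (liftTm g')) =
          liftTm (fun X => (g X).sub f' g') := by
        funext X; simp only [liftTm, Shape.sub_ren, Shape.ren_sub]; rfl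
      rw [Shape.sub, Shape.sub, Shape.sub, U.sub_sub, T.sub_sub, lift_comp, h]
    | tfn S T =>
      have h : (fun X => (liftTy g X).sub f' (liftTy g')) =
          liftTy (fun X => (g X).sub f' g') := by
        funext X
        cases X with
        | zero => rfl
        | succ X => simp only [liftTy, Shape.sub_ren, Shape.ren_sub]; rfl
      rw [Shape.sub, Shape.sub, Shape.sub, S.sub_sub, T.sub_sub, h]
    | box T => rw [Shape.sub, Shape.sub, Shape.sub, T.sub_sub]
  theorem Ty.sub_sub (f : ℕ → ℕ) (g : ℕ → Shape) (f' : ℕ → ℕ) (g' : ℕ → Shape) (T : Ty) :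
      (T.sub f g).sub f' g' = T.sub (f' ∘ f) (fun X => (g X).sub f' g') := by
    cases T with
    | capt C S => rw [Ty.sub, Ty.sub, Ty.sub, S.sub_sub, CapSet.ren_ren]
end

theorem Shape.sub_lift_weaken (f : ℕ → ℕ) (g : ℕ → Shape) (S : Shape) :
    (S.ren Nat.succ id).sub (lift f) (liftTm g) = (S.sub f g).ren Nat.succ id := by
  rw [Shape.sub_ren, Shape.ren_sub]; rfl

theorem Ty.sub_lift_weaken (f : ℕ → ℕ) (g : ℕ → Shape) (T : Ty) :
    (T.ren Nat.succ id).sub (lift f) (liftTm g) = (T.sub f g).ren Nat.succ id := by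
  rw [Ty.sub_ren, Ty.ren_sub]; rfl

theorem Shape.sub_liftTy_weaken (f : ℕ → ℕ) (g : ℕ → Shape) (S : Shape) :
    (S.ren id Nat.succ).sub f (liftTy g) = (S.sub f g).ren id Nat.succ := by
  rw [Shape.sub_ren, Shape.ren_sub]; rfl

theorem Ty.sub_liftTy_weaken (f : ℕ → ℕ) (g : ℕ → Shape) (T : Ty) :
    (T.ren id Nat.succ).sub f (liftTy g) = (T.sub f g).ren id Nat.succ := by
  rw [Ty.sub_ren, Ty.ren_sub]; rfl

theorem Ty.sub_instVar (f : ℕ → ℕ) (g : ℕ → Shape) (y : ℕ) (T : Ty) :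
    (T.ren (instVar y) id).sub f g =
      (T.sub (lift f) (liftTm g)).ren (instVar (f y)) id := by
  rw [Ty.sub_ren, Ty.ren_sub]
  congr 1
  · funext n; cases n <;> rfl
  · funext X
    simp only [liftTm]
    rw [Shape.ren_ren, Shape.ren_eq_sub]
    exact (Shape.sub_id _).symm

theorem Ty.sub_instTy (f : ℕ → ℕ) (g : ℕ → Shape) (S : Shape) (T : Ty) :
    (T.tsubst (instTy S)).sub f g =
      (T.sub f (liftTy g)).tsubst (instTy (S.sub f g)) := by
  rw [Ty.tsubst_eq_sub, Ty.tsubst_eq_sub, Ty.sub_sub, Ty.sub_sub]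
  congr 1
  funext X
  cases X with
  | zero => rfl
  | succ X =>
    simp only [liftTy, Shape.sub_ren]
    exact (Shape.sub_id _).symm

theorem Ty.weaken_instVar (y : ℕ) (T : Ty) : (T.ren Nat.succ id).ren (instVar y) id = T := by
  rw [Ty.ren_ren, Ty.ren_eq_sub]
  exact T.sub_id

theorem Ty.weaken_instTy (S : Shape) (T : Ty) : (T.ren id Nat.succ).tsubst (instTy S) = T := by
  rw [Ty.tsubst_eq_sub, Ty.sub_ren]
  exact T.sub_id

/-- Simultaneous renaming of term variables by `f` and substitution of type variables by `g`. -/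
def Tm.sub (f : ℕ → ℕ) (g : ℕ → Shape) : Tm → Tm
  | .var x => .var (f x)
  | .lam U t => .lam (U.sub f g) (t.sub (lift f) (liftTm g))
  | .tlam S t => .tlam (S.sub f g) (t.sub f (liftTy g))
  | .box x => .box (f x)
  | .app x y => .app (f x) (f y)
  | .tapp x S => .tapp (f x) (S.sub f g)
  | .letin s t => .letin (s.sub f g) (t.sub (lift f) (liftTm g))
  | .unbox C x => .unbox (C.ren f) (f x)

theorem Tm.ren_eq_sub (f g : ℕ → ℕ) (t : Tm) :
    t.ren f g = t.sub f (fun X => .tvar (g X)) := by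
  induction t generalizing f g with
  | lam U t ih => rw [Tm.ren, Tm.sub, ih, U.ren_eq_sub, liftTm_tvar]
  | tlam S t ih => rw [Tm.ren, Tm.sub, ih, S.ren_eq_sub, liftTy_tvar]
  | tapp x S => rw [Tm.ren, Tm.sub, S.ren_eq_sub]
  | letin s t ih₁ ih₂ => rw [Tm.ren, Tm.sub, ih₁, ih₂, liftTm_tvar]
  | _ => rfl

theorem Tm.tsubst_eq_sub (g : ℕ → Shape) (t : Tm) : t.tsubst g = t.sub id g := by
  induction t generalizing g with
  | lam U t ih => rw [Tm.tsubst, Tm.sub, ih, U.tsubst_eq_sub, lift_id]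
  | tlam S t ih => rw [Tm.tsubst, Tm.sub, ih, S.tsubst_eq_sub]
  | tapp x S => rw [Tm.tsubst, Tm.sub, S.tsubst_eq_sub]; rfl
  | letin s t ih₁ ih₂ => rw [Tm.tsubst, Tm.sub, ih₁, ih₂, lift_id]
  | unbox C x => rw [Tm.tsubst, Tm.sub, CapSet.ren_id]; rfl
  | _ => rfl

theorem Tm.isValue_sub (f : ℕ → ℕ) (g : ℕ → Shape) (t : Tm) :
    (t.sub f g).isValue = t.isValue := by
  cases t <;> rfl

/-- This holds even for non-injective `f`. The case distinction for `let` is stable because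
substitution preserves being a value and `lift f` sends no index except `0` to `0`. -/
theorem Tm.cv_sub (f : ℕ → ℕ) (g : ℕ → Shape) (t : Tm) : (t.sub f g).cv = t.cv.ren f := by
  induction t generalizing f g with
  | lam U t ih => rw [Tm.sub, Tm.cv, Tm.cv, ih, CapSet.unbind_ren_lift]
  | tlam S t ih => rw [Tm.sub, Tm.cv, Tm.cv, ih]
  | letin s t ih₁ ih₂ =>
    simp only [Tm.sub, Tm.cv, ih₁, ih₂, Tm.isValue_sub, CapSet.zero_mem_ren_lift,
      CapSet.unbind_ren_lift]
    split
    · rfl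
    · simp [CapSet.ren, Finset.image_union]
  | app x y => simp [Tm.sub, Tm.cv, CapSet.ren]
  | unbox C x => simp [Tm.sub, Tm.cv, CapSet.ren]
  | _ => simp [Tm.sub, Tm.cv]

@[simp] theorem Ty.cs_ren (f g : ℕ → ℕ) (T : Ty) : (T.ren f g).cs = T.cs.ren f := by
  cases T; rfl

@[simp] theorem Ty.sh_ren (f g : ℕ → ℕ) (T : Ty) : (T.ren f g).sh = T.sh.ren f g := by
  cases T; rfl

@[simp] theorem Ty.cs_sub (f : ℕ → ℕ) (g : ℕ → Shape) (T : Ty) :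
    (T.sub f g).cs = T.cs.ren f := by
  cases T; rfl

@[simp] theorem Ty.sh_sub (f : ℕ → ℕ) (g : ℕ → Shape) (T : Ty) :
    (T.sub f g).sh = T.sh.sub f g := by
  cases T; rfl

/-! ### Renaming of contexts -/

/-- The maps `f` and `g` carry the bindings of `Γ` to bindings of `Γ'`. -/
structure Ren (f g : ℕ → ℕ) (Γ Γ' : Ctx) : Prop where
  var {x : ℕ} {T : Ty} : HasVar Γ x T → HasVar Γ' (f x) (T.ren f g)
  tvar {X : ℕ} {S : Shape} : HasTVar Γ X S → HasTVar Γ' (g X) (S.ren f g)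

theorem Ren.lift {f g : ℕ → ℕ} {Γ Γ' : Ctx} (h : Ren f g Γ Γ') (U : Ty) :
    Ren (CaptureCalculus.lift f) g (.var Γ U) (.var Γ' (U.ren f g)) := by
  have e (T : Ty) : (T.ren Nat.succ id).ren (CaptureCalculus.lift f) g =
      (T.ren f g).ren Nat.succ id := by
    rw [Ty.ren_ren, Ty.ren_ren]; rfl
  have e' (T : Shape) : (T.ren Nat.succ id).ren (CaptureCalculus.lift f) g =
      (T.ren f g).ren Nat.succ id := by
    rw [Shape.ren_ren, Shape.ren_ren]; rfl
  constructor
  · rintro x T (_ | h₁)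
    · rw [e]; exact .here
    · rw [e]; exact .skipVar (h.var h₁)
  · rintro X S (_ | h₁)
    rw [e']; exact .skipVar (h.tvar h₁)

theorem Ren.liftTy {f g : ℕ → ℕ} {Γ Γ' : Ctx} (h : Ren f g Γ Γ') (S : Shape) :
    Ren f (CaptureCalculus.lift g) (.tvar Γ S) (.tvar Γ' (S.ren f g)) := by
  have e (T : Ty) : (T.ren id Nat.succ).ren f (CaptureCalculus.lift g) =
      (T.ren f g).ren id Nat.succ := by
    rw [Ty.ren_ren, Ty.ren_ren]; rfl
  have e' (T : Shape) : (T.ren id Nat.succ).ren f (CaptureCalculus.lift g) =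
      (T.ren f g).ren id Nat.succ := by
    rw [Shape.ren_ren, Shape.ren_ren]; rfl
  constructor
  · rintro x T (_ | _ | h₁)
    rw [e]; exact .skipTVar (h.var h₁)
  · rintro X S (_ | _ | h₁)
    · rw [e']; exact .here
    · rw [e']; exact .skipTVar (h.tvar h₁)

theorem Ren.weaken (Γ : Ctx) (T : Ty) : Ren Nat.succ id Γ (.var Γ T) :=
  ⟨.skipVar, .skipVar⟩

theorem Ren.weakenTy (Γ : Ctx) (S : Shape) : Ren id Nat.succ Γ (.tvar Γ S) :=
  ⟨.skipTVar, .skipTVar⟩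

theorem HasVar.unique {Γ : Ctx} {x : ℕ} {T T' : Ty} (h : HasVar Γ x T) (h' : HasVar Γ x T') :
    T = T' := by
  induction h generalizing T' with
  | here => cases h'; rfl
  | skipVar _ ih => cases h' with | skipVar h' => rw [ih h']
  | skipTVar _ ih => cases h' with | skipTVar h' => rw [ih h']

/-! ### Subcapturing -/

theorem Subcapt.of_subset {Γ : Ctx} {C D : CapSet} (h : C ⊆ D) : Subcapt Γ C D :=
  .set fun _ hc => .elem (h hc)

theorem Subcapt.refl {Γ : Ctx} {C : CapSet} : Subcapt Γ C C :=
  .of_subset subset_rfl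

theorem Subcapt.mem {Γ : Ctx} {C D : CapSet} (h : Subcapt Γ C D) {c : Option ℕ} (hc : c ∈ C) :
    Subcapt Γ {c} D := by
  cases h with
  | elem h => rw [Finset.mem_singleton.1 hc]; exact .elem h
  | set h => exact h c hc
  | var hx h => rw [Finset.mem_singleton.1 hc]; exact .var hx h

theorem Subcapt.trans {Γ : Ctx} {C₁ C₂ C₃ : CapSet} (h : Subcapt Γ C₁ C₂)
    (h' : Subcapt Γ C₂ C₃) : Subcapt Γ C₁ C₃ := by
  induction h with
  | elem hc => exact h'.mem hc
  | set _ ih => exact .set fun c hc => ih c hc h'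
  | var hx _ ih => exact .var hx (ih h')

/-- Stability under plain renamings comes first: lifting a typed substitution `SubMor` under a
binder already requires weakening. -/
theorem Subcapt.ren {f g : ℕ → ℕ} {Γ Γ' : Ctx} {C D : CapSet} (h : Subcapt Γ C D)
    (hr : Ren f g Γ Γ') : Subcapt Γ' (C.ren f) (D.ren f) := by
  induction h with
  | elem hc =>
    rw [CapSet.ren_singleton]
    exact .elem (CapSet.mem_ren.2 ⟨_, hc, rfl⟩)
  | set _ ih =>
    refine .set fun c hc => ?_
    obtain ⟨d, hd, rfl⟩ := CapSet.mem_ren.1 hc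
    simpa using ih d hd
  | var hx _ ih =>
    rw [CapSet.ren_singleton]
    exact .var (hr.var hx) ih

/-! ### Subtyping -/

theorem Subtyp.ren {f g : ℕ → ℕ} {Γ Γ' : Ctx} {T U : Ty} (h : Subtyp Γ T U)
    (hr : Ren f g Γ Γ') : Subtyp Γ' (T.ren f g) (U.ren f g) := by
  induction h generalizing f g Γ' with
  | refl => exact .refl
  | trans _ _ ih₁ ih₂ => exact .trans (ih₁ hr) (ih₂ hr)
  | tvar h => exact .tvar (hr.tvar h)
  | top => exact .top
  | fn _ _ ih₁ ih₂ => exact .fn (ih₁ hr) (ih₂ (hr.lift _))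
  | tfn _ _ ih₁ ih₂ => exact .tfn (ih₁ hr) (ih₂ (hr.liftTy _))
  | capt hC _ ih => exact .capt (hC.ren hr) (ih hr)
  | boxed _ ih => exact .boxed (ih hr)

theorem Subtyp.cs {Γ : Ctx} {T U : Ty} (h : Subtyp Γ T U) : Subcapt Γ T.cs U.cs := by
  induction h with
  | trans _ _ ih₁ ih₂ => exact ih₁.trans ih₂
  | capt hC _ _ => exact hC
  | _ => exact .refl

theorem Subtyp.sh {Γ : Ctx} {T U : Ty} (h : Subtyp Γ T U) :
    Subtyp Γ T.sh.toTy U.sh.toTy := by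
  induction h with
  | refl => exact .refl
  | trans _ _ ih₁ ih₂ => exact .trans ih₁ ih₂
  | tvar h => exact .tvar h
  | top => exact .top
  | fn h₁ h₂ => exact .fn h₁ h₂
  | tfn h₁ h₂ => exact .tfn h₁ h₂
  | capt _ h _ => exact h
  | boxed h => exact .boxed h

/-! ### Well-formedness -/

theorem Ctx.some_mem_dom {Γ : Ctx} {x : ℕ} : some x ∈ Γ.dom ↔ ∃ T, HasVar Γ x T := by
  constructor
  · rintro ⟨y, T, e, h⟩
    cases e
    exact ⟨T, h⟩
  · rintro ⟨T, h⟩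
    exact ⟨x, T, rfl, h⟩

theorem CapSet.ren_subset_dom {f : ℕ → ℕ} {Γ Γ' : Ctx} {C : CapSet}
    (h : ∀ {x T}, HasVar Γ x T → ∃ T', HasVar Γ' (f x) T')
    (hC : (C : Set (Option ℕ)) ⊆ Γ.dom) : (C.ren f : Set (Option ℕ)) ⊆ Γ'.dom := by
  intro c hc
  obtain ⟨d, hd, rfl⟩ := CapSet.mem_ren.1 hc
  obtain ⟨x, T, rfl, hx⟩ := hC hd
  exact Ctx.some_mem_dom.2 (h hx)

theorem CapSet.ren_subset {f : ℕ → ℕ} {Γ Γ' : Ctx} {C : CapSet}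
    (h : ∀ {x T}, HasVar Γ x T → ∃ T', HasVar Γ' (f x) T')
    (hC : (C : Set (Option ℕ)) ⊆ Γ.dom ∪ {none}) :
    (C.ren f : Set (Option ℕ)) ⊆ Γ'.dom ∪ {none} := by
  intro c hc
  obtain ⟨d, hd, rfl⟩ := CapSet.mem_ren.1 hc
  rcases hC hd with ⟨x, T, rfl, hx⟩ | hd
  · exact .inl (Ctx.some_mem_dom.2 (h hx))
  · rw [Set.mem_singleton_iff.1 hd]; exact .inr rfl

mutual
  theorem Shape.WF.ren {f g : ℕ → ℕ} {Γ Γ' : Ctx} {S : Shape} (h : S.WF Γ)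
      (hr : Ren f g Γ Γ') : (S.ren f g).WF Γ' := by
    cases S with
    | tvar X => exact ⟨_, hr.tvar h.choose_spec⟩
    | top => trivial
    | fn U T => exact ⟨Ty.WF.ren h.1 hr, Ty.WF.ren h.2 (hr.lift U)⟩
    | tfn S T => exact ⟨Shape.WF.ren h.1 hr, Ty.WF.ren h.2 (hr.liftTy S)⟩
    | box T => exact Ty.WF.ren (T := T) h hr
  theorem Ty.WF.ren {f g : ℕ → ℕ} {Γ Γ' : Ctx} {T : Ty} (h : T.WF Γ)
      (hr : Ren f g Γ Γ') : (T.ren f g).WF Γ' := by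
    cases T with
    | capt C S => exact ⟨Shape.WF.ren h.1 hr, CapSet.ren_subset (fun hx => ⟨_, hr.var hx⟩) h.2⟩
end

/-- The maps `f` and `g` carry the variables bound in `Γ` to variables bound in `Γ'` and to shapes
that are well-formed in `Γ'`. -/
structure DomMor (f : ℕ → ℕ) (g : ℕ → Shape) (Γ Γ' : Ctx) : Prop where
  var {x : ℕ} {T : Ty} : HasVar Γ x T → ∃ T', HasVar Γ' (f x) T'
  tvar {X : ℕ} {S : Shape} : HasTVar Γ X S → (g X).WF Γ'

/-- Well-formedness depends only on which variables are bound, so the two new bindings need not be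
related. -/
theorem DomMor.lift {f : ℕ → ℕ} {g : ℕ → Shape} {Γ Γ' : Ctx} (h : DomMor f g Γ Γ') (U U' : Ty) :
    DomMor (CaptureCalculus.lift f) (liftTm g) (.var Γ U) (.var Γ' U') := by
  constructor
  · rintro x T (_ | h₁)
    · exact ⟨_, .here⟩
    · obtain ⟨T', h₂⟩ := h.var h₁
      exact ⟨_, .skipVar h₂⟩
  · rintro X S (_ | h₁)
    exact (h.tvar h₁).ren (.weaken _ _)

theorem DomMor.liftTy {f : ℕ → ℕ} {g : ℕ → Shape} {Γ Γ' : Ctx} (h : DomMor f g Γ Γ')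
    (S S' : Shape) : DomMor f (CaptureCalculus.liftTy g) (.tvar Γ S) (.tvar Γ' S') := by
  constructor
  · rintro x T (_ | _ | h₁)
    obtain ⟨T', h₂⟩ := h.var h₁
    exact ⟨_, .skipTVar h₂⟩
  · rintro X S (_ | _ | h₁)
    · exact ⟨_, .here⟩
    · exact (h.tvar h₁).ren (.weakenTy _ _)

mutual
  theorem Shape.WF.sub {f : ℕ → ℕ} {g : ℕ → Shape} {Γ Γ' : Ctx} {S : Shape} (h : S.WF Γ)
      (hm : DomMor f g Γ Γ') : (S.sub f g).WF Γ' := by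
    cases S with
    | tvar X => exact hm.tvar h.choose_spec
    | top => trivial
    | fn U T => exact ⟨Ty.WF.sub h.1 hm, Ty.WF.sub h.2 (hm.lift _ _)⟩
    | tfn S T => exact ⟨Shape.WF.sub h.1 hm, Ty.WF.sub h.2 (hm.liftTy _ _)⟩
    | box T => exact Ty.WF.sub (T := T) h hm
  theorem Ty.WF.sub {f : ℕ → ℕ} {g : ℕ → Shape} {Γ Γ' : Ctx} {T : Ty} (h : T.WF Γ)
      (hm : DomMor f g Γ Γ') : (T.sub f g).WF Γ' := by
    cases T with
    | capt C S => exact ⟨Shape.WF.sub h.1 hm, CapSet.ren_subset hm.var h.2⟩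
end

/-- The maps `f` and `g` carry only variables bound in `Γ` to variables bound in `Γ'`. -/
structure DomRefl (f g : ℕ → ℕ) (Γ Γ' : Ctx) : Prop where
  var {x : ℕ} {T : Ty} : HasVar Γ' (f x) T → ∃ T', HasVar Γ x T'
  tvar {X : ℕ} {S : Shape} : HasTVar Γ' (g X) S → ∃ S', HasTVar Γ X S'

theorem DomRefl.lift {f g : ℕ → ℕ} {Γ Γ' : Ctx} (h : DomRefl f g Γ Γ') (U U' : Ty) :
    DomRefl (CaptureCalculus.lift f) g (.var Γ U) (.var Γ' U') := by
  constructor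
  · rintro (_ | x) T h₁
    · exact ⟨_, .here⟩
    · cases h₁ with
      | skipVar h₁ =>
        obtain ⟨T', h₂⟩ := h.var h₁
        exact ⟨_, .skipVar h₂⟩
  · rintro X S h₁
    cases h₁ with
    | skipVar h₁ =>
      obtain ⟨S', h₂⟩ := h.tvar h₁
      exact ⟨_, .skipVar h₂⟩

theorem DomRefl.liftTy {f g : ℕ → ℕ} {Γ Γ' : Ctx} (h : DomRefl f g Γ Γ') (S S' : Shape) :
    DomRefl f (CaptureCalculus.lift g) (.tvar Γ S) (.tvar Γ' S') := by
  constructor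
  · rintro x T h₁
    cases h₁ with
    | skipTVar h₁ =>
      obtain ⟨T', h₂⟩ := h.var h₁
      exact ⟨_, .skipTVar h₂⟩
  · rintro (_ | X) S h₁
    · exact ⟨_, .here⟩
    · cases h₁ with
      | skipTVar h₁ =>
        obtain ⟨S', h₂⟩ := h.tvar h₁
        exact ⟨_, .skipTVar h₂⟩

theorem DomRefl.weaken (Γ : Ctx) (T : Ty) : DomRefl Nat.succ id Γ (.var Γ T) := by
  constructor
  · intro x U h
    cases h with | skipVar h => exact ⟨_, h⟩
  · intro X S h
    cases h with | skipVar h => exact ⟨_, h⟩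

mutual
  theorem Shape.WF.of_ren {f g : ℕ → ℕ} {Γ Γ' : Ctx} {S : Shape} (h : (S.ren f g).WF Γ')
      (hr : DomRefl f g Γ Γ') : S.WF Γ := by
    cases S with
    | tvar X => exact hr.tvar h.choose_spec
    | top => trivial
    | fn U T => exact ⟨Ty.WF.of_ren h.1 hr, Ty.WF.of_ren h.2 (hr.lift _ _)⟩
    | tfn S T => exact ⟨Shape.WF.of_ren h.1 hr, Ty.WF.of_ren h.2 (hr.liftTy _ _)⟩
    | box T => exact Ty.WF.of_ren (T := T) h hr
  theorem Ty.WF.of_ren {f g : ℕ → ℕ} {Γ Γ' : Ctx} {T : Ty} (h : (T.ren f g).WF Γ')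
      (hr : DomRefl f g Γ Γ') : T.WF Γ := by
    cases T with
    | capt C S =>
      refine ⟨Shape.WF.of_ren h.1 hr, fun c hc => ?_⟩
      cases c with
      | none => exact .inr rfl
      | some x =>
        obtain ⟨y, T, e, h₁⟩ | e := h.2 (CapSet.mem_ren.2 ⟨_, hc, rfl⟩)
        · cases e
          exact .inl (Ctx.some_mem_dom.2 (hr.var h₁))
        · cases e
end

/-- All types in the context are well-formed. -/
structure Ctx.OK (Γ : Ctx) : Prop where
  var {x : ℕ} {T : Ty} : HasVar Γ x T → T.WF Γ
  tvar {X : ℕ} {S : Shape} : HasTVar Γ X S → S.WF Γ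

theorem Ctx.OK.nil : Ctx.nil.OK := ⟨nofun, nofun⟩

theorem Ctx.OK.cons {Γ : Ctx} (h : Γ.OK) {T : Ty} (hT : T.WF Γ) : (Γ.var T).OK := by
  constructor
  · rintro x U (_ | h₁)
    · exact hT.ren (.weaken _ _)
    · exact (h.var h₁).ren (.weaken _ _)
  · rintro X S (_ | h₁)
    exact (h.tvar h₁).ren (.weaken _ _)

theorem Ctx.OK.consTy {Γ : Ctx} (h : Γ.OK) {S : Shape} (hS : S.WF Γ) : (Γ.tvar S).OK := by
  constructor
  · rintro x U (_ | _ | h₁)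
    exact (h.var h₁).ren (.weakenTy _ _)
  · rintro X S (_ | _ | h₁)
    · exact hS.ren (.weakenTy _ _)
    · exact (h.tvar h₁).ren (.weakenTy _ _)

theorem DomMor.instVar {Γ : Ctx} {y : ℕ} {T : Ty} (hy : HasVar Γ y T) (U : Ty) :
    DomMor (CaptureCalculus.instVar y) .tvar (.var Γ U) Γ := by
  constructor
  · rintro x T (_ | h₁)
    · exact ⟨_, hy⟩
    · exact ⟨_, h₁⟩
  · rintro X S (_ | h₁)
    exact ⟨_, h₁⟩

theorem DomMor.instTy {Γ : Ctx} {S : Shape} (hS : S.WF Γ) (S' : Shape) :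
    DomMor id (CaptureCalculus.instTy S) (.tvar Γ S') Γ := by
  constructor
  · rintro x T (_ | _ | h₁)
    exact ⟨_, h₁⟩
  · rintro X S (_ | _ | h₁)
    · exact hS
    · exact ⟨_, h₁⟩

/-! ### Inversion of typing -/

theorem HasType.var_inv' {Γ : Ctx} {t : Tm} {T : Ty} (h : HasType Γ t T) {x : ℕ}
    (e : t = .var x) :
    ∃ C S, HasVar Γ x (.capt C S) ∧ Subtyp Γ (.capt {some x} S) T := by
  induction h with
  | var h => cases e; exact ⟨_, _, h, .refl⟩
  | sub _ hs _ ih =>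
    obtain ⟨C, S, h₁, h₂⟩ := ih e
    exact ⟨C, S, h₁, h₂.trans hs⟩
  | _ => cases e

theorem HasType.var_inv {Γ : Ctx} {x : ℕ} {T : Ty} (h : HasType Γ (.var x) T) :
    ∃ C S, HasVar Γ x (.capt C S) ∧ Subtyp Γ (.capt {some x} S) T :=
  h.var_inv' rfl

theorem CapSet.unbind_subset {Γ : Ctx} {U : Ty} {C : CapSet}
    (h : (C : Set (Option ℕ)) ⊆ (Γ.var U).dom ∪ {none}) :
    (C.unbind : Set (Option ℕ)) ⊆ Γ.dom ∪ {none} := by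
  intro c hc
  have hc' := h (CapSet.mem_unbind.1 hc)
  cases c with
  | none => exact .inr rfl
  | some x =>
    obtain ⟨y, T, e, h₁⟩ | e := hc'
    · cases e
      cases h₁ with | skipVar h₁ => exact .inl (Ctx.some_mem_dom.2 ⟨_, h₁⟩)
    · cases e

/-- The claims are proved together: the type of an abstraction carries captured variables of its
body, so its well-formedness needs the second claim, while the body of a `let` is typed in a context
that is well-formed by the first. -/
theorem HasType.wf_cv {Γ : Ctx} {t : Tm} {T : Ty} (h : HasType Γ t T) (hΓ : Γ.OK) :
    T.WF Γ ∧ (t.cv : Set (Option ℕ)) ⊆ Γ.dom ∪ {none} := by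
  have hvar {Γ : Ctx} {x : ℕ} {T : Ty} (h : HasType Γ (.var x) T) : some x ∈ Γ.dom := by
    obtain ⟨C, S, h, -⟩ := h.var_inv
    exact Ctx.some_mem_dom.2 ⟨_, h⟩
  induction h with
  | @var Γ x C S h =>
    have hx : (({some x} : CapSet) : Set (Option ℕ)) ⊆ Γ.dom ∪ {none} := by
      rw [Finset.coe_singleton, Set.singleton_subset_iff]
      exact .inl (Ctx.some_mem_dom.2 ⟨_, h⟩)
    exact ⟨⟨(hΓ.var h).1, hx⟩, hx⟩
  | sub _ _ hU ih => exact ⟨hU, (ih hΓ).2⟩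
  | abs _ hU ih =>
    have ⟨h₁, h₂⟩ := ih (hΓ.cons hU)
    exact ⟨⟨⟨hU, h₁⟩, CapSet.unbind_subset h₂⟩, CapSet.unbind_subset h₂⟩
  | @tabs Γ t S T _ hS ih =>
    have ⟨h₁, h₂⟩ := ih (hΓ.consTy hS)
    have h₃ : (t.cv : Set (Option ℕ)) ⊆ Γ.dom ∪ {none} := by
      intro c hc
      rcases h₂ hc with ⟨x, U, rfl, h⟩ | hc
      · cases h with | skipTVar h => exact .inl (Ctx.some_mem_dom.2 ⟨_, h⟩)
      · exact .inr hc
    exact ⟨⟨⟨hS, h₁⟩, h₃⟩, h₃⟩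
  | app hx hy ihx ihy =>
    obtain ⟨D, S, hy', -⟩ := hy.var_inv
    refine ⟨?_, ?_⟩
    · rw [Ty.ren_eq_sub]
      exact (ihx hΓ).1.1.2.sub (.instVar hy' _)
    · simp only [Tm.cv, Finset.coe_insert, Finset.coe_singleton, Set.insert_subset_iff,
        Set.singleton_subset_iff]
      exact ⟨.inl (hvar hx), .inl (hvar hy)⟩
  | tapp hx ih =>
    have h := (ih hΓ).1.1
    refine ⟨?_, (ih hΓ).2⟩
    rw [Ty.tsubst_eq_sub]
    -- The rule uses the bound itself as type argument, so the argument is well-formed because the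
    -- quantified shape is.
    exact h.2.sub (.instTy h.1 _)
  | box _ _ ih => exact ⟨⟨(ih hΓ).1, by simp⟩, by simp [Tm.cv]⟩
  | unbox hx hC ih =>
    refine ⟨(ih hΓ).1.1, ?_⟩
    simp only [Tm.cv, Finset.coe_union, Finset.coe_singleton, Set.union_subset_iff,
      Set.singleton_subset_iff]
    exact ⟨hC.trans Set.subset_union_left, .inl (hvar hx)⟩
  | @letin Γ s t T U _ _ ihs iht =>
    have ⟨h₁, h₂⟩ := ihs hΓ
    have ⟨h₃, h₄⟩ := iht (hΓ.cons h₁)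
    refine ⟨?_, ?_⟩
    -- The result type is known to be well-formed only after weakening, so well-formedness has to be
    -- reflected back.
    · exact Ty.WF.of_ren h₃ (.weaken Γ T)
    · rw [Tm.cv]
      split
      · exact CapSet.unbind_subset h₄
      · rw [Finset.coe_union]
        exact Set.union_subset h₂ (CapSet.unbind_subset h₄)

/-! ### Substitution -/

/-- A substitution from `Γ` to `Γ'` that respects typing up to subtyping.  It covers weakening,
narrowing, and substitution of term and type variables. -/
structure SubMor (f : ℕ → ℕ) (g : ℕ → Shape) (Γ Γ' : Ctx) : Prop where
  var {x : ℕ} {T : Ty} : HasVar Γ x T → ∃ C S, HasVar Γ' (f x) (.capt C S) ∧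
    Subcapt Γ' {some (f x)} (T.sub f g).cs ∧ Subtyp Γ' S.toTy (T.sub f g).sh.toTy
  tvar {X : ℕ} {S : Shape} : HasTVar Γ X S →
    (g X).WF Γ' ∧ Subtyp Γ' (g X).toTy (S.sub f g).toTy

theorem HasVar.subcapt {Γ : Ctx} {x : ℕ} {T : Ty} (h : HasVar Γ x T) :
    Subcapt Γ {some x} T.cs := by
  cases T
  exact .var h .refl

theorem SubMor.of_var {f : ℕ → ℕ} {g : ℕ → Shape} {Γ' : Ctx} {x : ℕ} {T : Ty}
    (h : HasVar Γ' (f x) (T.sub f g)) : ∃ C S, HasVar Γ' (f x) (.capt C S) ∧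
      Subcapt Γ' {some (f x)} (T.sub f g).cs ∧ Subtyp Γ' S.toTy (T.sub f g).sh.toTy := by
  cases T
  exact ⟨_, _, h, .var h .refl, .refl⟩

theorem SubMor.dom {f : ℕ → ℕ} {g : ℕ → Shape} {Γ Γ' : Ctx} (h : SubMor f g Γ Γ') :
    DomMor f g Γ Γ' := by
  constructor
  · intro x T hx
    obtain ⟨C, S, h₁, -⟩ := h.var hx
    exact ⟨_, h₁⟩
  · exact fun hX => (h.tvar hX).1

theorem SubMor.of_ren {f g : ℕ → ℕ} {Γ Γ' : Ctx} (h : Ren f g Γ Γ') :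
    SubMor f (fun X => .tvar (g X)) Γ Γ' := by
  constructor
  · intro x T hx
    exact SubMor.of_var (Ty.ren_eq_sub f g T ▸ h.var hx)
  · intro X S hX
    exact ⟨⟨_, h.tvar hX⟩, Shape.ren_eq_sub f g S ▸ .tvar (h.tvar hX)⟩

theorem SubMor.lift {f : ℕ → ℕ} {g : ℕ → Shape} {Γ Γ' : Ctx} (h : SubMor f g Γ Γ') (U : Ty) :
    SubMor (CaptureCalculus.lift f) (liftTm g) (.var Γ U) (.var Γ' (U.sub f g)) := by
  constructor
  · rintro x T (_ | h₁)
    · refine SubMor.of_var ?_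
      rw [Ty.sub_lift_weaken]
      exact .here
    · obtain ⟨C, S, h₂, h₃, h₄⟩ := h.var h₁
      rw [Ty.sub_lift_weaken]
      refine ⟨_, _, .skipVar h₂, ?_, ?_⟩
      · simpa using! h₃.ren (.weaken _ _)
      · simpa [Ty.ren] using h₄.ren (.weaken _ _)
  · rintro X S (_ | h₁)
    obtain ⟨h₂, h₃⟩ := h.tvar h₁
    rw [Shape.sub_lift_weaken]
    exact ⟨h₂.ren (.weaken _ _), h₃.ren (.weaken _ _)⟩

theorem SubMor.liftTy {f : ℕ → ℕ} {g : ℕ → Shape} {Γ Γ' : Ctx} (h : SubMor f g Γ Γ')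
    (S : Shape) :
    SubMor f (CaptureCalculus.liftTy g) (.tvar Γ S) (.tvar Γ' (S.sub f g)) := by
  constructor
  · rintro x T (_ | _ | h₁)
    obtain ⟨C, S, h₂, h₃, h₄⟩ := h.var h₁
    rw [Ty.sub_liftTy_weaken]
    refine ⟨_, _, .skipTVar h₂, ?_, ?_⟩
    · simpa using h₃.ren (.weakenTy _ _)
    · simpa [Ty.ren] using h₄.ren (.weakenTy _ _)
  · rintro X S (_ | _ | h₁)
    · rw [Shape.sub_liftTy_weaken]
      exact ⟨⟨_, .here⟩, .tvar .here⟩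
    · obtain ⟨h₂, h₃⟩ := h.tvar h₁
      rw [Shape.sub_liftTy_weaken]
      exact ⟨h₂.ren (.weakenTy _ _), h₃.ren (.weakenTy _ _)⟩

theorem Subcapt.sub {f : ℕ → ℕ} {g : ℕ → Shape} {Γ Γ' : Ctx} {C D : CapSet}
    (h : Subcapt Γ C D) (hm : SubMor f g Γ Γ') : Subcapt Γ' (C.ren f) (D.ren f) := by
  induction h with
  | elem hc =>
    rw [CapSet.ren_singleton]
    exact .elem (CapSet.mem_ren.2 ⟨_, hc, rfl⟩)
  | set _ ih =>
    refine .set fun c hc => ?_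
    obtain ⟨d, hd, rfl⟩ := CapSet.mem_ren.1 hc
    simpa using ih d hd
  | var hx _ ih =>
    obtain ⟨_, _, _, h₁, _⟩ := hm.var hx
    rw [CapSet.ren_singleton]
    exact h₁.trans ih

theorem Subtyp.sub {f : ℕ → ℕ} {g : ℕ → Shape} {Γ Γ' : Ctx} {T U : Ty} (h : Subtyp Γ T U)
    (hm : SubMor f g Γ Γ') : Subtyp Γ' (T.sub f g) (U.sub f g) := by
  induction h generalizing f g Γ' with
  | refl => exact .refl
  | trans _ _ ih₁ ih₂ => exact .trans (ih₁ hm) (ih₂ hm)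
  | tvar h => exact (hm.tvar h).2
  | top => exact .top
  | fn _ _ ih₁ ih₂ => exact .fn (ih₁ hm) (ih₂ (hm.lift _))
  | tfn _ _ ih₁ ih₂ => exact .tfn (ih₁ hm) (ih₂ (hm.liftTy _))
  | capt hC _ ih => exact .capt (hC.sub hm) (ih hm)
  | boxed _ ih => exact .boxed (ih hm)

/-- Well-formedness of the source context supplies the side condition of the subsumption used for
variables, and it is maintained under binders. The target context needs no such assumption. -/
theorem HasType.sub_mor {f : ℕ → ℕ} {g : ℕ → Shape} {Γ Γ' : Ctx} {t : Tm} {T : Ty}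
    (h : HasType Γ t T) (hΓ : Γ.OK) (hm : SubMor f g Γ Γ') :
    HasType Γ' (t.sub f g) (T.sub f g) := by
  induction h generalizing f g Γ' with
  | @var Γ x C S h =>
    obtain ⟨D, R, h₁, -, h₂⟩ := hm.var h
    have hx : HasType Γ' (.var (f x)) (.capt {some (f x)} R) := .var h₁
    rw [Ty.sub, CapSet.ren_singleton]
    refine .sub hx (.capt .refl h₂) ⟨(hΓ.var h).1.sub hm.dom, ?_⟩
    rw [Option.map_some, Finset.coe_singleton, Set.singleton_subset_iff]
    exact .inl (Ctx.some_mem_dom.2 ⟨_, h₁⟩)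
  | sub _ hs hU ih => exact .sub (ih hΓ hm) (hs.sub hm) (hU.sub hm.dom)
  | abs _ hU ih =>
    have h₁ := HasType.abs (ih (hΓ.cons hU) (hm.lift _)) (hU.sub hm.dom)
    rwa [Tm.cv_sub, CapSet.unbind_ren_lift] at h₁
  | tabs _ hS ih =>
    have h₁ := HasType.tabs (ih (hΓ.consTy hS) (hm.liftTy _)) (hS.sub hm.dom)
    rwa [Tm.cv_sub] at h₁
  | app _ _ ih₁ ih₂ =>
    rw [Ty.sub_instVar]
    exact .app (ih₁ hΓ hm) (ih₂ hΓ hm)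
  | tapp _ ih =>
    rw [Ty.sub_instTy]
    exact .tapp (ih hΓ hm)
  | box _ hC ih => exact .box (ih hΓ hm) (CapSet.ren_subset_dom hm.dom.var hC)
  | unbox _ hC ih => exact .unbox (ih hΓ hm) (CapSet.ren_subset_dom hm.dom.var hC)
  | letin h₁ _ ih₁ ih₂ =>
    have h₂ := ih₂ (hΓ.cons (h₁.wf_cv hΓ).1) (hm.lift _)
    rw [Ty.sub_lift_weaken] at h₂
    exact .letin (ih₁ hΓ hm) h₂

theorem HasType.ren {f g : ℕ → ℕ} {Γ Γ' : Ctx} {t : Tm} {T : Ty}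
    (h : HasType Γ t T) (hΓ : Γ.OK) (hr : Ren f g Γ Γ') :
    HasType Γ' (t.ren f g) (T.ren f g) := by
  rw [Tm.ren_eq_sub, Ty.ren_eq_sub]
  exact h.sub_mor hΓ (.of_ren hr)

/-- The identity on type variables is written `fun X => .tvar (id X)` so that `Ty.ren_eq_sub` and
`Tm.ren_eq_sub` can be rewritten backwards. -/
theorem SubMor.instVar {Γ : Ctx} {y : ℕ} {U : Ty} (hy : HasType Γ (.var y) U) :
    SubMor (CaptureCalculus.instVar y) (fun X => .tvar (id X)) (.var Γ U) Γ := by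
  obtain ⟨C, S, h₁, h₂⟩ := hy.var_inv
  constructor
  · rintro x T (_ | h)
    · rw [← Ty.ren_eq_sub, Ty.weaken_instVar]
      exact ⟨C, S, h₁, h₂.cs, h₂.sh⟩
    · refine SubMor.of_var ?_
      rw [← Ty.ren_eq_sub, Ty.weaken_instVar]
      exact h
  · rintro X S (_ | @⟨_, _, S, _, h⟩)
    refine ⟨⟨_, h⟩, ?_⟩
    rw [Shape.sub_ren]
    exact (Shape.sub_id S).symm ▸ .tvar h

theorem SubMor.instTy {Γ : Ctx} {S U : Shape} (hS : S.WF Γ) (h : Subtyp Γ S.toTy U.toTy) :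
    SubMor id (CaptureCalculus.instTy S) (.tvar Γ U) Γ := by
  have e (R : Shape) : (R.ren id Nat.succ).sub id (CaptureCalculus.instTy S) = R := by
    rw [Shape.sub_ren]
    exact R.sub_id
  constructor
  · rintro x T (_ | _ | h)
    refine SubMor.of_var ?_
    rw [← Ty.tsubst_eq_sub, Ty.weaken_instTy]
    exact h
  · rintro X R (_ | _ | h)
    · rw [e]
      exact ⟨hS, h⟩
    · rw [e]
      exact ⟨⟨_, h⟩, .tvar h⟩

theorem SubMor.narrow {Γ : Ctx} {U U' : Ty} (h : Subtyp Γ U' U) :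
    SubMor id .tvar (.var Γ U) (.var Γ U') := by
  constructor
  · rintro x T (_ | h₁)
    · rw [Ty.sub_id]
      have h₂ := h.ren (.weaken Γ U')
      cases U'
      exact ⟨_, _, .here, (HasVar.subcapt .here).trans h₂.cs, h₂.sh⟩
    · refine SubMor.of_var ?_
      rw [Ty.sub_id]
      exact .skipVar h₁
  · rintro X S (_ | h₁)
    rw [Shape.sub_id]
    exact ⟨⟨_, .skipVar h₁⟩, .tvar (.skipVar h₁)⟩

theorem SubMor.narrowTy {Γ : Ctx} {S S' : Shape} (h : Subtyp Γ S'.toTy S.toTy) :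
    SubMor id .tvar (.tvar Γ S) (.tvar Γ S') := by
  constructor
  · rintro x T (_ | _ | h₁)
    refine SubMor.of_var ?_
    rw [Ty.sub_id]
    exact .skipTVar h₁
  · rintro X R (_ | _ | h₁)
    · rw [Shape.sub_id]
      exact ⟨⟨_, .here⟩, .trans (.tvar .here) (h.ren (.weakenTy _ _))⟩
    · rw [Shape.sub_id]
      exact ⟨⟨_, .skipTVar h₁⟩, .tvar (.skipTVar h₁)⟩

theorem Subtyp.narrow {Γ : Ctx} {U U' T T' : Ty} (h : Subtyp (.var Γ U) T T')
    (hU : Subtyp Γ U' U) : Subtyp (.var Γ U') T T' := by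
  have h₁ := h.sub (.narrow hU)
  rwa [Ty.sub_id, Ty.sub_id] at h₁

theorem Subtyp.narrowTy {Γ : Ctx} {S S' : Shape} {T T' : Ty} (h : Subtyp (.tvar Γ S) T T')
    (hS : Subtyp Γ S'.toTy S.toTy) : Subtyp (.tvar Γ S') T T' := by
  have h₁ := h.sub (.narrowTy hS)
  rwa [Ty.sub_id, Ty.sub_id] at h₁

/-! ### Inversion of subtyping in contexts without type variables -/

/-- Without type variables, only reflexivity, transitivity, the capturing rule and the function rule
can end at a function shape. Speaking of `sh` lets the induction pass through the capturing rule;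
transitivity needs narrowing to align the contexts of the codomains. -/
theorem Subtyp.inv_fn {Γ : Ctx} {T T' : Ty} (h : Subtyp Γ T T')
    (hΓ : ∀ X S, ¬ HasTVar Γ X S) {U₂ T₂ : Ty} (e : T'.sh = .fn U₂ T₂) :
    ∃ U₁ T₁, T.sh = .fn U₁ T₁ ∧ Subtyp Γ U₂ U₁ ∧ Subtyp (.var Γ U₂) T₁ T₂ := by
  induction h generalizing U₂ T₂ with
  | refl => exact ⟨_, _, e, .refl, .refl⟩
  | trans _ _ ih₁ ih₂ =>
    obtain ⟨U₁, T₁, e₁, h₁, h₂⟩ := ih₂ hΓ e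
    obtain ⟨U₀, T₀, e₀, h₃, h₄⟩ := ih₁ hΓ e₁
    exact ⟨U₀, T₀, e₀, h₁.trans h₃, (h₄.narrow h₁).trans h₂⟩
  | tvar h => exact absurd h (hΓ _ _)
  | top => cases e
  | fn h₁ h₂ => cases e; exact ⟨_, _, rfl, h₁, h₂⟩
  | tfn => cases e
  | capt _ _ ih => exact ih hΓ e
  | boxed => cases e

theorem Subtyp.inv_tfn {Γ : Ctx} {T T' : Ty} (h : Subtyp Γ T T')
    (hΓ : ∀ X S, ¬ HasTVar Γ X S) {S₂ : Shape} {T₂ : Ty} (e : T'.sh = .tfn S₂ T₂) :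
    ∃ S₁ T₁, T.sh = .tfn S₁ T₁ ∧ Subtyp Γ S₂.toTy S₁.toTy ∧
      Subtyp (.tvar Γ S₂) T₁ T₂ := by
  induction h generalizing S₂ T₂ with
  | refl => exact ⟨_, _, e, .refl, .refl⟩
  | trans _ _ ih₁ ih₂ =>
    obtain ⟨U₁, T₁, e₁, h₁, h₂⟩ := ih₂ hΓ e
    obtain ⟨U₀, T₀, e₀, h₃, h₄⟩ := ih₁ hΓ e₁
    exact ⟨U₀, T₀, e₀, h₁.trans h₃, (h₄.narrowTy h₁).trans h₂⟩
  | tvar h => exact absurd h (hΓ _ _)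
  | top => cases e
  | fn => cases e
  | tfn h₁ h₂ => cases e; exact ⟨_, _, rfl, h₁, h₂⟩
  | capt _ _ ih => exact ih hΓ e
  | boxed => cases e

theorem Subtyp.inv_box {Γ : Ctx} {T T' : Ty} (h : Subtyp Γ T T')
    (hΓ : ∀ X S, ¬ HasTVar Γ X S) {T₂ : Ty} (e : T'.sh = .box T₂) :
    ∃ T₁, T.sh = .box T₁ ∧ Subtyp Γ T₁ T₂ := by
  induction h generalizing T₂ with
  | refl => exact ⟨_, e, .refl⟩
  | trans _ _ ih₁ ih₂ =>
    obtain ⟨T₁, e₁, h₁⟩ := ih₂ hΓ e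
    obtain ⟨T₀, e₀, h₂⟩ := ih₁ hΓ e₁
    exact ⟨T₀, e₀, h₂.trans h₁⟩
  | tvar h => exact absurd h (hΓ _ _)
  | top => cases e
  | fn => cases e
  | tfn => cases e
  | capt _ _ ih => exact ih hΓ e
  | boxed h => cases e; exact ⟨_, rfl, h⟩

/-! ### Inversion of typing for values and `let` -/

theorem HasType.inv_lam {Γ : Ctx} {s t : Tm} {U T : Ty} (h : HasType Γ s T)
    (e : s = .lam U t) :
    ∃ T₁, HasType (.var Γ U) t T₁ ∧ U.WF Γ ∧ Subtyp Γ (Shape.fn U T₁).toTy T.sh.toTy := by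
  induction h with
  | sub _ hs _ ih =>
    obtain ⟨T₁, h₁, h₂, h₃⟩ := ih e
    exact ⟨T₁, h₁, h₂, h₃.trans hs.sh⟩
  | abs h hU => cases e; exact ⟨_, h, hU, .refl⟩
  | _ => cases e

theorem HasType.inv_tlam {Γ : Ctx} {s t : Tm} {S : Shape} {T : Ty} (h : HasType Γ s T)
    (e : s = .tlam S t) :
    ∃ T₁, HasType (.tvar Γ S) t T₁ ∧ S.WF Γ ∧ Subtyp Γ (Shape.tfn S T₁).toTy T.sh.toTy := by
  induction h with
  | sub _ hs _ ih =>
    obtain ⟨T₁, h₁, h₂, h₃⟩ := ih e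
    exact ⟨T₁, h₁, h₂, h₃.trans hs.sh⟩
  | tabs h hS => cases e; exact ⟨_, h, hS, .refl⟩
  | _ => cases e

theorem HasType.inv_box {Γ : Ctx} {s : Tm} {x : ℕ} {T : Ty} (h : HasType Γ s T)
    (e : s = .box x) :
    ∃ T₁, HasType Γ (.var x) T₁ ∧ Subtyp Γ (Shape.box T₁).toTy T.sh.toTy := by
  induction h with
  | sub _ hs _ ih =>
    obtain ⟨T₁, h₁, h₂⟩ := ih e
    exact ⟨T₁, h₁, h₂.trans hs.sh⟩
  | box h => cases e; exact ⟨_, h, .refl⟩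
  | _ => cases e

/-- Subsumption on a `let` can be pushed into its body after weakening, so the result type remains
exactly `U`. -/
theorem HasType.inv_letin' {Γ : Ctx} {r s t : Tm} {U : Ty} (h : HasType Γ r U)
    (e : r = .letin s t) :
    ∃ T, HasType Γ s T ∧ HasType (.var Γ T) t (U.ren Nat.succ id) := by
  induction h with
  | sub _ hs hU ih =>
    obtain ⟨T, h₁, h₂⟩ := ih e
    exact ⟨T, h₁, h₂.sub (hs.ren (.weaken _ _)) (hU.ren (.weaken _ _))⟩
  | letin h₁ h₂ => cases e; exact ⟨_, h₁, h₂⟩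
  | _ => cases e

theorem HasType.inv_letin {Γ : Ctx} {s t : Tm} {U : Ty} (h : HasType Γ (.letin s t) U) :
    ∃ T, HasType Γ s T ∧ HasType (.var Γ T) t (U.ren Nat.succ id) :=
  h.inv_letin' rfl

/-! ### Type preservation for redexes -/

theorem HasType.apply {Γ : Ctx} (hΓ : Γ.OK) (hn : ∀ X S, ¬ HasTVar Γ X S) {r t : Tm} {x y : ℕ}
    {D U T : Ty} (hx : HasVar Γ x D) (hv : HasType Γ (.lam U t) D)
    (h : HasType Γ r T) (e : r = .app x y) : HasType Γ (t.ren (instVar y) id) T := by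
  induction h with
  | sub _ hs hU ih => exact .sub (ih hΓ hn hx hv e) hs hU
  | app h₁ h₂ =>
    cases e
    obtain ⟨C₀, S₀, h₃, h₄⟩ := h₁.var_inv
    cases hx.unique h₃
    obtain ⟨T₁, h₅, h₆, h₇⟩ := hv.inv_lam rfl
    -- The chain runs from the lambda's own function shape through the type recorded for `x` to the
    -- shape used at the call. Inverting it lets the argument be retyped at the lambda's annotation.
    obtain ⟨U₂, T₂, e, h₈, h₉⟩ := (h₇.trans h₄.sh).inv_fn hn rfl
    cases e
    have hb := h₅.sub_mor (hΓ.cons h₆) (.instVar (h₂.sub h₈ h₆))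
    rw [← Tm.ren_eq_sub] at hb
    refine hb.sub ?_ ((h₁.app h₂).wf_cv hΓ).1
    rw [Ty.ren_eq_sub]
    exact h₉.sub (.instVar h₂)
  | _ => cases e

theorem HasType.tapply {Γ : Ctx} (hΓ : Γ.OK) (hn : ∀ X S, ¬ HasTVar Γ X S) {r t : Tm} {x : ℕ}
    {S S' : Shape} {D T : Ty} (hx : HasVar Γ x D) (hv : HasType Γ (.tlam S' t) D)
    (h : HasType Γ r T) (e : r = .tapp x S) : HasType Γ (t.tsubst (instTy S)) T := by
  induction h with
  | sub _ hs hU ih => exact .sub (ih hΓ hn hx hv e) hs hU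
  | tapp h₁ =>
    cases e
    obtain ⟨C₀, S₀, h₃, h₄⟩ := h₁.var_inv
    cases hx.unique h₃
    obtain ⟨T₁, h₅, h₆, h₇⟩ := hv.inv_tlam rfl
    obtain ⟨U₂, T₂, e, h₈, h₉⟩ := (h₇.trans h₄.sh).inv_tfn hn rfl
    cases e
    have hS : S.WF _ := (h₁.wf_cv hΓ).1.1.1
    rw [Tm.tsubst_eq_sub]
    refine (h₅.sub_mor (hΓ.consTy h₆) (.instTy hS h₈)).sub ?_ (h₁.tapp.wf_cv hΓ).1
    rw [Ty.tsubst_eq_sub]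
    exact h₉.sub (.instTy hS .refl)
  | _ => cases e

theorem HasType.open_box {Γ : Ctx} (hΓ : Γ.OK) (hn : ∀ X S, ¬ HasTVar Γ X S) {r : Tm} {x y : ℕ}
    {C : CapSet} {D T : Ty} (hx : HasVar Γ x D) (hv : HasType Γ (.box y) D)
    (h : HasType Γ r T) (e : r = .unbox C x) : HasType Γ (.var y) T := by
  induction h with
  | sub _ hs hU ih => exact .sub (ih hΓ hn hx hv e) hs hU
  | unbox h₁ hC =>
    cases e
    obtain ⟨C₀, S₀, h₃, h₄⟩ := h₁.var_inv
    cases hx.unique h₃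
    obtain ⟨T₁, h₅, h₆⟩ := hv.inv_box rfl
    obtain ⟨T₂, e, h₇⟩ := (h₆.trans h₄.sh).inv_box hn rfl
    cases e
    exact h₅.sub h₇ (h₁.wf_cv hΓ).1.1
  | _ => cases e

theorem HasType.rename {Γ : Ctx} (hΓ : Γ.OK) {t : Tm} {y : ℕ} {T : Ty}
    (h : HasType Γ (.letin (.var y) t) T) : HasType Γ (t.ren (instVar y) id) T := by
  obtain ⟨U, h₁, h₂⟩ := h.inv_letin
  have h₃ := h₂.sub_mor (hΓ.cons (h₁.wf_cv hΓ).1) (.instVar h₁)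
  rwa [← Tm.ren_eq_sub, ← Ty.ren_eq_sub, Ty.weaken_instVar] at h₃

theorem HasType.plug {Γ : Ctx} {r r' : Tm} (hr : ∀ T, HasType Γ r T → HasType Γ r' T)
    (e : ECtx) {T : Ty} (h : HasType Γ (e.plug r) T) : HasType Γ (e.plug r') T := by
  induction e generalizing T with
  | hole => exact hr T h
  | letin e t ih =>
    obtain ⟨U, h₁, h₂⟩ := HasType.inv_letin h
    exact .letin (ih h₁) h₂

theorem HasType.lift_let {Γ : Ctx} (hΓ : Γ.OK) {v t : Tm} (e : ECtx) {T : Ty}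
    (h : HasType Γ (e.plug (.letin v t)) T) : HasType Γ (.letin v (e.weaken.plug t)) T := by
  induction e generalizing T with
  | hole => exact h
  | letin e u ih =>
    obtain ⟨U, h₁, h₂⟩ := HasType.inv_letin h
    obtain ⟨V, h₃, h₄⟩ := (ih h₁).inv_letin
    -- The body of the surrounding `let` now lies under the extra binder for `v`, inserted just
    -- outside its own variable.
    have h₅ := h₂.ren (hΓ.cons (h₁.wf_cv hΓ).1) ((Ren.weaken Γ V).lift U)
    rw [Ty.ren_ren] at h₅
    refine .letin h₃ (.letin h₄ ?_)
    rw [Ty.ren_ren]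
    exact h₅

/-! ### Stores -/

theorem Ren.append (Γ : Ctx) (Δ : List Ty) : Ren (· + Δ.length) id Γ (Γ.append Δ) := by
  induction Δ generalizing Γ with
  | nil =>
    have hT (T : Ty) : T.ren id id = T := by rw [Ty.ren_eq_sub]; exact T.sub_id
    have hS (S : Shape) : S.ren id id = S := by rw [Shape.ren_eq_sub]; exact S.sub_id
    exact ⟨fun h => (hT _).symm ▸ h, fun h => (hS _).symm ▸ h⟩
  | cons U Δ ih =>
    have e : (· + Δ.length) ∘ Nat.succ = (· + (U :: Δ).length) := by
      funext n; simp only [Function.comp, List.length_cons]; omega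
    constructor
    · intro x T h
      have h₁ := (ih (Γ.var U)).var (.skipVar h)
      rw [Ty.ren_ren, e] at h₁
      exact (congrFun e x) ▸ h₁
    · intro X S h
      have h₁ := (ih (Γ.var U)).tvar (.skipVar h)
      rwa [Shape.ren_ren, e] at h₁

theorem Matches.length_eq {Γ : Ctx} {σ : Store} {Δ : List Ty} (h : Matches Γ σ Δ) :
    σ.length = Δ.length := by
  induction h with
  | hole => rfl
  | letv _ _ ih => rw [Store.length, ih, List.length_cons]

theorem Matches.ok {Γ : Ctx} {σ : Store} {Δ : List Ty} (h : Matches Γ σ Δ) (hΓ : Γ.OK) :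
    (Γ.append Δ).OK := by
  induction h with
  | hole => exact hΓ
  | letv _ hv ih => exact ih (hΓ.cons (hv.wf_cv hΓ).1)

theorem Matches.lookup {Γ : Ctx} {σ : Store} {Δ : List Ty} (h : Matches Γ σ Δ) (hΓ : Γ.OK)
    {x : ℕ} {v : Tm} (hx : σ.lookup x = some v) :
    ∃ T, HasVar (Γ.append Δ) x T ∧ HasType (Γ.append Δ) v T := by
  induction h with
  | hole => cases hx
  | @letv Γ w hw σ T Δ hσ hv ih =>
    rw [Store.lookup] at hx
    split at hx
    · rename_i e
      cases hx
      have h₁ := hv.ren hΓ (.append Γ (T :: Δ))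
      have h₂ := (Ren.append (Γ.var T) Δ).var .here
      rw [Ty.ren_ren] at h₂
      -- The declared type is shifted once past its own binder and then past the rest of the store.
      -- This is the single shift by `σ.length + 1` that `Store.lookup` applies to the value.
      have e' : (· + Δ.length) ∘ Nat.succ = (· + (T :: Δ).length) := by
        funext n; simp only [Function.comp, List.length_cons]; omega
      rw [e, hσ.length_eq]
      refine ⟨_, ?_, h₁⟩
      rw [← e']
      simpa [Ctx.append] using h₂
    · exact ih (hΓ.cons (hv.wf_cv hΓ).1) hx

theorem Ctx.not_hasTVar_append {Γ : Ctx} (hΓ : ∀ X S, ¬ HasTVar Γ X S) (Δ : List Ty) :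
    ∀ X S, ¬ HasTVar (Γ.append Δ) X S := by
  induction Δ generalizing Γ with
  | nil => exact hΓ
  | cons T Δ ih =>
    refine ih ?_
    rintro X S (_ | h)
    exact hΓ _ _ h

/-- The store context `σ[τ]`. -/
def Store.comp : Store → Store → Store
  | .hole, τ => τ
  | .letv v hv σ, τ => .letv v hv (σ.comp τ)

theorem Store.plug_comp (σ τ : Store) (t : Tm) : (σ.comp τ).plug t = σ.plug (τ.plug t) := by
  induction σ with
  | hole => rfl
  | letv v hv σ ih => rw [Store.comp, Store.plug, ih, Store.plug]

theorem Store.comp_assoc (σ τ υ : Store) : (σ.comp τ).comp υ = σ.comp (τ.comp υ) := by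
  induction σ with
  | hole => rfl
  | letv v hv σ ih => rw [Store.comp, Store.comp, ih, Store.comp]

theorem Store.comp_hole (σ : Store) : σ.comp .hole = σ := by
  induction σ with
  | hole => rfl
  | letv v hv σ ih => rw [Store.comp, ih]

theorem Store.plug_injective (σ : Store) {s t : Tm} (h : σ.plug s = σ.plug t) : s = t := by
  induction σ with
  | hole => exact h
  | letv v hv σ ih => exact ih (Tm.letin.inj h).2

theorem Matches.comp {Γ : Ctx} {σ τ : Store} {Δ Δ' : List Ty} (h : Matches Γ σ Δ)
    (h' : Matches (Γ.append Δ) τ Δ') : Matches Γ (σ.comp τ) (Δ ++ Δ') := by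
  induction h with
  | hole => exact h'
  | letv _ hv ih => exact .letv (ih h') hv

/-- If `τ` ended before `σ`, then `s` would begin with one of the remaining value bindings of `σ`,
which `hs` excludes. -/
theorem Store.eq_comp {σ τ : Store} {t s : Tm} (h : σ.plug t = τ.plug s)
    (hs : ∀ v u, v.isValue = true → s ≠ .letin v u) :
    ∃ υ : Store, τ = σ.comp υ ∧ t = υ.plug s := by
  induction σ generalizing τ with
  | hole => exact ⟨τ, rfl, h⟩
  | letv v hv σ ih =>
    cases τ with
    | hole => exact absurd h.symm (hs _ _ hv)
    | letv w hw τ =>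
      obtain ⟨rfl, h₁⟩ := Tm.letin.inj h
      obtain ⟨υ, rfl, h₂⟩ := ih h₁
      exact ⟨υ, rfl, h₂⟩

/-- The bindings of `τ` move one at a time into the matched store. Inverting each `let` only
provides some type for its value, so `hs` must cover every context matching `σ.comp τ`. -/
theorem HasType.plug_store {σ τ : Store} {Δ : List Ty} {s s' : Tm} {T : Ty}
    (hσ : Matches .nil σ Δ) (h : HasType (Ctx.nil.append Δ) (τ.plug s) T)
    (hs : ∀ Δ' T', Matches .nil (σ.comp τ) Δ' → HasType (Ctx.nil.append Δ') s T' →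
      HasType (Ctx.nil.append Δ') s' T') :
    HasType (Ctx.nil.append Δ) (τ.plug s') T := by
  induction τ generalizing σ Δ T with
  | hole => exact hs Δ T (by rwa [Store.comp_hole]) h
  | letv v hv τ ih =>
    obtain ⟨V, h₁, h₂⟩ := HasType.inv_letin h
    have e : (Ctx.nil.append Δ).var V = Ctx.nil.append (Δ ++ [V]) := by
      simp [Ctx.append, List.foldl_append]
    have hσ' : Matches .nil (σ.comp (.letv v hv .hole)) (Δ ++ [V]) :=
      hσ.comp (.letv .hole h₁)
    refine .letin h₁ ?_
    rw [e] at h₂ ⊢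
    refine ih hσ' h₂ fun Δ' T' hm => hs Δ' T' ?_
    rwa [Store.comp_assoc] at hm

/-! ### Type preservation -/

theorem ECtx.isValue_plug (e : ECtx) {r : Tm} (h : r.isValue = false) :
    (e.plug r).isValue = false := by
  cases e with
  | hole => exact h
  | letin => rfl

/-- For `e` other than the hole, the outermost `let` binds a term containing the redex in evaluation
position, hence not a value. Only the hole needs a condition on `r`, and the lifting rule excludes
that case by its premise. -/
theorem ECtx.plug_ne (e : ECtx) {r : Tm} (h : r.isValue = false)
    (hr : e = .hole → ∀ v u, v.isValue = true → r ≠ .letin v u) (v u : Tm)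
    (hv : v.isValue = true) : e.plug r ≠ .letin v u := by
  cases e with
  | hole => exact hr rfl v u hv
  | letin e t =>
    intro he
    rw [← (Tm.letin.inj he).1, e.isValue_plug h] at hv
    cases hv

theorem Step.preservation {σ : Store} {Δ : List Ty} {t u : Tm} {T : Ty}
    (hσ : Matches .nil σ Δ) (ht : HasType (Ctx.nil.append Δ) t T) (h : Step (σ.plug t) u) :
    ∃ t', u = σ.plug t' ∧ HasType (Ctx.nil.append Δ) t' T := by
  -- Each rule changes only what is in the hole of its own store `τ`. As `τ` extends `σ`, it is
  -- enough to preserve types there, in all contexts matching `τ`.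
  have key {τ : Store} {s s' : Tm} (e : σ.plug t = τ.plug s)
      (hs : ∀ v u, v.isValue = true → s ≠ .letin v u)
      (hp : ∀ Δ' T', Matches .nil τ Δ' → HasType (Ctx.nil.append Δ') s T' →
        HasType (Ctx.nil.append Δ') s' T') :
      ∃ t', τ.plug s' = σ.plug t' ∧ HasType (Ctx.nil.append Δ) t' T := by
    obtain ⟨υ, rfl, rfl⟩ := Store.eq_comp e hs
    exact ⟨_, Store.plug_comp _ _ _, HasType.plug_store hσ ht hp⟩
  have hn (Δ' : List Ty) := Ctx.not_hasTVar_append (Γ := .nil) nofun Δ'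
  generalize e : σ.plug t = w at h
  cases h with
  | apply hx =>
    refine key e (ECtx.plug_ne _ rfl nofun) fun Δ' T' hm h => ?_
    obtain ⟨D, h₁, h₂⟩ := hm.lookup .nil hx
    exact h.plug (fun _ h => .apply (hm.ok .nil) (hn _) h₁ h₂ h rfl) _
  | tapply hx =>
    refine key e (ECtx.plug_ne _ rfl nofun) fun Δ' T' hm h => ?_
    obtain ⟨D, h₁, h₂⟩ := hm.lookup .nil hx
    exact h.plug (fun _ h => .tapply (hm.ok .nil) (hn _) h₁ h₂ h rfl) _
  | unbox hx =>
    refine key e (ECtx.plug_ne _ rfl nofun) fun Δ' T' hm h => ?_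
    obtain ⟨D, h₁, h₂⟩ := hm.lookup .nil hx
    exact h.plug (fun _ h => .open_box (hm.ok .nil) (hn _) h₁ h₂ h rfl) _
  | rename =>
    refine key e (ECtx.plug_ne _ rfl ?_) fun Δ' T' hm h => ?_
    · rintro - v u hv ⟨⟩
      cases hv
    · exact h.plug (fun _ h => h.rename (hm.ok .nil)) _
  | lift hv he =>
    exact key e (ECtx.plug_ne _ rfl fun h => absurd h he) fun Δ' T' hm h =>
      h.lift_let (hm.ok .nil) _

theorem Steps.preservation {σ : Store} {Δ : List Ty} {t u : Tm} {T : Ty}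
    (hσ : Matches .nil σ Δ) (ht : HasType (Ctx.nil.append Δ) t T) (h : Steps (σ.plug t) u) :
    ∃ t', u = σ.plug t' ∧ HasType (Ctx.nil.append Δ) t' T := by
  induction h with
  | refl => exact ⟨t, rfl, ht⟩
  | tail _ hs ih =>
    obtain ⟨t', rfl, ht'⟩ := ih
    exact hs.preservation hσ ht'

/-! ### Capture prediction -/

/-- A shifted set cannot contain the innermost variable, so a derivation that starts at this
variable must look up its declared capture set, that of `V`. The separate `D'` with an equation
keeps the right-hand side general for induction. -/
theorem Subcapt.strengthen {Γ : Ctx} {V : Ty} {C D D' : CapSet} (h : Subcapt (.var Γ V) C D')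
    (e : D' = D.ren Nat.succ) :
    Subcapt Γ C.unbind D ∧ (some 0 ∈ C → Subcapt Γ V.cs D) := by
  induction h with
  | @elem c C hc =>
    subst e
    obtain ⟨d, hd, rfl⟩ := CapSet.mem_ren.1 hc
    refine ⟨.set fun c hc => ?_, fun h => ?_⟩
    · have := Option.map_injective Nat.succ_injective
        (Finset.mem_singleton.1 (CapSet.mem_unbind.1 hc))
      exact this ▸ .elem hd
    · cases d <;> simp at h
  | set _ ih =>
    refine ⟨.set fun c hc => ?_, fun h => (ih _ h e).2 (by simp)⟩
    exact (ih _ (CapSet.mem_unbind.1 hc) e).1.mem (CapSet.mem_unbind.2 (by simp))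
  | @var x C' C S hx _ ih =>
    have h₁ := (ih e).1
    -- Every declared capture set in the extended context is a shifted one; unbinding undoes the
    -- shift, so the induction hypothesis applies to the original set.
    have hu (B : CapSet) (hB : B.ren Nat.succ = C') : Subcapt Γ B D := by
      refine .set fun c hc => h₁.mem (CapSet.mem_unbind.2 ?_)
      exact hB ▸ CapSet.mem_ren.2 ⟨c, hc, rfl⟩
    generalize hT : Ty.capt C' S = T at hx
    have hC : T.cs = C' := hT ▸ rfl
    cases hx with
    | here =>
      refine ⟨.set fun c hc => ?_, fun _ => hu _ (by simpa using hC)⟩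
      have := Finset.mem_singleton.1 (CapSet.mem_unbind.1 hc)
      cases c <;> simp at this
    | @skipVar _ x T _ hx =>
      refine ⟨.set fun c hc => ?_, fun h => by simp at h⟩
      have := Finset.mem_singleton.1 (CapSet.mem_unbind.1 hc)
      obtain rfl : c = some x := by cases c <;> simp_all
      exact hx.subcapt.trans (hu _ (by simpa using hC))

/-- The syntax-directed rule for an answer assigns exactly its captured variables, and the capture
sets then grow along subsumption. -/
theorem HasType.cv_answer {Γ : Ctx} {a : Tm} {T : Ty} (h : HasType Γ a T)
    (ha : a.isAnswer = true) : Subcapt Γ a.cv T.cs := by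
  induction h with
  | sub _ hs _ ih => exact (ih ha).trans hs.cs
  | var => exact .refl
  | abs => exact .refl
  | tabs => exact .refl
  | box => exact .refl
  | _ => cases ha

theorem HasType.cv_plug_answer {Γ : Ctx} {σ : Store} {a : Tm} {T : Ty}
    (h : HasType Γ (σ.plug a) T) (ha : a.isAnswer = true) :
    Subcapt Γ (σ.plug a).cv T.cs := by
  induction σ generalizing Γ T with
  | hole => exact h.cv_answer ha
  | letv v hv σ ih =>
    obtain ⟨V, h₁, h₂⟩ := HasType.inv_letin h
    obtain ⟨h₃, h₄⟩ := (ih h₂).strengthen (Ty.cs_ren _ _ _)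
    rw [Store.plug, Tm.cv]
    split
    · exact h₃
    · rename_i hc
      -- The bound term is a value, so `cv(v)` is counted only when the bound variable is captured.
      -- This is what makes the second half of the strengthening available.
      have h₀ : some 0 ∈ (σ.plug a).cv := by
        by_contra h₀
        exact hc ⟨hv, h₀⟩
      have hva : v.isAnswer = true := by cases v <;> first | rfl | exact hv
      have h₅ := (h₁.cv_answer hva).trans (h₄ h₀)
      exact .set fun c hc => (Finset.mem_union.1 hc).elim h₅.mem h₃.mem

end CaptureCalculus

theorem mainTheorem3 (σ σ' : CaptureCalculus.Store) (Δ : List CaptureCalculus.Ty)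
    (t a : CaptureCalculus.Tm) (C : CaptureCalculus.CapSet) (R : CaptureCalculus.Shape)
    (hσ : CaptureCalculus.Matches .nil σ Δ)
    (ht : CaptureCalculus.HasType (CaptureCalculus.Ctx.nil.append Δ) t (.capt C R))
    (ha : a.isAnswer = true)
    (hred : CaptureCalculus.Steps (σ.plug t) (σ.plug (σ'.plug a))) :
    CaptureCalculus.Subcapt (CaptureCalculus.Ctx.nil.append Δ) (σ'.plug a).cv C := by
  obtain ⟨t', e, ht'⟩ := hred.preservation hσ ht
  -- Both decompositions of the final term have the same outer store, so the preserved type belongs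
  -- to `σ'[a]`.
  rw [← σ.plug_injective e] at ht'
  exact ht'.cv_plug_answer ha
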